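/- Let $\Theta$ and $\mathbb{Y}$ be Polish spaces with fixed compatible metrics and their Borel $\sigma$-algebras; a measure on $\Theta$ is called locally finite if it is finite on bounded sets. For $c>0$ and measures $H,M$ on $\Theta$, a locally finite random measure $W$ is a noncentral gamma random measure, $W\sim \mathrm{Nc}\mathcal{G}a\mathrm{P}(H,M,c^{-1})$, if $\mathrm{E}\,e^{-\int f\,dW}=\exp\big(-\int\log(1+cf)\,dH-\int\frac{cf}{1+cf}\,dM\big)$ for all nonnegative bounded measurable $f$ with bounded support. Let $H$ be locally finite, let $\beta_t,c_t>0$ for $t\ge 2$, and let $(W_t)_{t\ge1}$ be a Markov process of locally finite random measures on $\Theta$ such that, given $W_1,\dots,W_t$, the law of $W_{t+1}$ is $\mathrm{Nc}\mathcal{G}a\mathrm{P}(H,\beta_{t+1}W_t,c_{t+1}^{-1})$. Let $\ell$ be a $\sigma$-finite measure on $\mathbb{Y}$, $K:\mathbb{Y}\times\Theta\to[0,\infty)$ measurable, $\kappa_t\ge 0$ deterministic for $t\geq 1$, and let $(N_t)_{t\ge1}$ be random measures on $\mathbb{Y}$ which, conditionally on $(W_t)_{t\ge1}$, are independent Poisson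 random measures with intensities $\Lambda_t(dy)=\kappa_t\big(\int_\Theta K(y,\theta)W_t(d\theta)\big)\ell(dy)$. Write $\bar W_1(\cdot)=\mathrm{E}(W_1(\cdot))$, assumed locally finite, $K(A,\theta)=\int_A K(y,\theta)\,\ell(dy)$, $\rho_j=\beta_jc_j$ and, for $s\ge t$, $$\rho_{s|t}=\prod_{j=t+1}^{s}\rho_j,\qquad c_{s|t}=c_s+\sum_{j=t+1}^{s-1}c_j\prod_{i=j+1}^{s}\rho_i\ \ (s>t),\qquad c_{t|t}=0,\qquad \beta_{s|t}=\rho_{s|t}/c_{s|t}\ \ (s>t),$$ so that $\rho_{t|t}=1$. Assume that for all bounded measurable $B,B_1',B_2'\subset\mathbb{Y}$: - $(H_1)$ $\int_B K(y,\theta)\,\ell(dy)<\infty$ for all $\theta$, and $\int_B\int_\Theta K(y,\theta)\,[H(d\theta)+\bar W_1(d\theta)]\,\ell(dy)<\infty$; - $(H_2)$ $\int_{B_1'\times B_2'}\int_\Theta K(y_1,\theta)K(y_2,\theta)\,[H(d\theta)+\bar W_1(d\theta)]\,\ell(dy_1)\ell(dy_2)<\infty$; - $(H_3)$ $\mathrm{E}\int_{B_1'\times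 B_2'}\int_\Theta K(y_1,\theta_1)W_1(d\theta_1)\int_\Theta K(y_2,\theta_2)W_1(d\theta_2)\,\ell(dy_1)\ell(dy_2)<\infty$. Let $B_1,B_2\subset\mathbb{Y}$ be measurable sets such that the quantities below are well defined, i.e. $\int_\Theta K(B_i,\theta)\,(H+\bar W_1)(d\theta)<\infty$ for $i=1,2$, $\int_\Theta K(B_1,\theta)K(B_2,\theta)\,(H+\bar W_1)(d\theta)<\infty$ and $\mathrm{E}\big(\int_\Theta K(B_1,\theta)W_1(d\theta)\int_\Theta K(B_2,\theta)W_1(d\theta)\big)<\infty$; this holds whenever $B_1$ and $B_2$ are bounded. Then for all integers $t\ge1$ and $h\ge0$ the variables $N_t(B_1)$, $N_{t+h}(B_2)$ are almost surely finite, they and their product are integrable, and $$\begin{aligned}\mathrm{cov}(N_t(B_1),N_{t+h}(B_2))={}&\kappa_t\kappa_{t+h}\,\rho_{t+h|t}\int_\Theta K(B_1,\theta)K(B_2,\theta)\,\big(c_{t|1}^2H(d\theta)+2c_{t|1}\rho_{t|1}\bar W_1(d\theta)\big)\\&+\kappa_t\kappa_{t+h}\,\rho_{t+h|t}\,\rho_{t|1}^2\,\mathrm{cov}\Big(\int_\Theta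 K(B_1,\theta)W_1(d\theta),\int_\Theta K(B_2,\theta)W_1(d\theta)\Big)\\&+\kappa_t\,\mathbf 1\{h=0\}\int_\Theta K(B_1\cap B_2,\theta)\,\big(c_{t|1}H(d\theta)+\rho_{t|1}\bar W_1(d\theta)\big).\end{aligned}$$ For $t\ge2$ the same holds with the two measures in parentheses written as $c_{t|1}^2\,(H+2\beta_{t|1}\bar W_1)$ and $c_{t|1}\,(H+\beta_{t|1}\bar W_1)$. -/

import Mathlib

open MeasureTheory ProbabilityTheory
open scoped ENNReal NNReal

/-- A measure on a metric space that is finite on every bounded set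
("locally finite" in the sense of random measure theory). -/
def IsBoundedlyFinite {X : Type*} [MetricSpace X] [MeasurableSpace X] (m : Measure X) : Prop :=
  ∀ B : Set X, Bornology.IsBounded B → m B < ∞

/-- `BM₊(X)`: nonnegative, bounded, measurable functions with bounded support. -/
structure IsBMPlus {X : Type*} [MetricSpace X] [MeasurableSpace X] (f : X → ℝ) : Prop where
  measurable : Measurable f
  nonneg : ∀ x, 0 ≤ f x
  bounded : ∃ C : ℝ, ∀ x, f x ≤ C
  bounded_support : Bornology.IsBounded (Function.support f)

/-- `Q`, a law on the space of measures on `Θ`, is the law of a noncentral gamma random measure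
`NcGaP(H, M, c⁻¹)`: it charges only boundedly finite measures, and its Laplace functional is
`f ↦ exp (- ∫ log (1 + c f) dH - ∫ c f / (1 + c f) dM)` on `BM₊(Θ)`. -/
structure IsNcGammaLaw {Θ : Type*} [MetricSpace Θ] [MeasurableSpace Θ]
    (Q : Measure (Measure Θ)) (H M : Measure Θ) (c : ℝ) : Prop where
  isProbabilityMeasure : IsProbabilityMeasure Q
  boundedlyFinite : ∀ᵐ w ∂Q, IsBoundedlyFinite w
  laplace : ∀ f : Θ → ℝ, IsBMPlus f →
    ∫ w, Real.exp (-∫ θ, f θ ∂w) ∂Q =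
      Real.exp (-(∫ θ, Real.log (1 + c * f θ) ∂H) - ∫ θ, c * f θ / (1 + c * f θ) ∂M)

/-- `Q`, a law on the space of measures on `Y`, is the law of a Poisson random measure with
intensity measure `L` (where a Poisson variable of infinite mean is the constant `∞`). -/
structure IsPoissonLaw {Y : Type*} [MeasurableSpace Y]
    (Q : Measure (Measure Y)) (L : Measure Y) : Prop where
  isProbabilityMeasure : IsProbabilityMeasure Q
  count_of_finite : ∀ B : Set Y, MeasurableSet B → L B ≠ ∞ →
    Q.map (fun n => n B) = (poissonMeasure (L B).toNNReal).map (fun k : ℕ => (k : ℝ≥0∞))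
  count_of_infinite : ∀ B : Set Y, MeasurableSet B → L B = ∞ → ∀ᵐ n ∂Q, n B = ∞
  indep : ∀ (k : ℕ) (B : Fin k → Set Y), (∀ i, MeasurableSet (B i)) →
    Pairwise (Function.onFun Disjoint B) → iIndepFun (fun i (n : Measure Y) => n (B i)) Q

/-- `ν` is a regular version of the conditional law of `X` given the sub-σ-algebra `m`. -/
structure IsCondLaw {Ω E : Type*} [MeasurableSpace Ω] [MeasurableSpace E] (P : Measure Ω)
    (m : MeasurableSpace Ω) (X : Ω → E) (ν : Ω → Measure E) : Prop where
  measurable : Measurable[m] ν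
  isProbabilityMeasure : ∀ ω, IsProbabilityMeasure (ν ω)
  setLIntegral_eq : ∀ F : Set Ω, MeasurableSet[m] F → ∀ A : Set E, MeasurableSet A →
    P (F ∩ X ⁻¹' A) = ∫⁻ ω in F, ν ω A ∂P

/-- The σ-algebra generated by `W_1, …, W_t`. -/
abbrev pastSigma {Ω E : Type*} [MeasurableSpace E] (W : ℕ → Ω → E) (t : ℕ) : MeasurableSpace Ω :=
  ⨆ s ∈ Set.Icc 1 t, MeasurableSpace.comap (W s) inferInstance

/-- The σ-algebra generated by the whole process `(W_t)_{t ≥ 1}`. -/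
abbrev fullSigma {Ω E : Type*} [MeasurableSpace E] (W : ℕ → Ω → E) : MeasurableSpace Ω :=
  ⨆ s ∈ Set.Ici 1, MeasurableSpace.comap (W s) inferInstance

/-- `(W_t)_{t ≥ 1}` is a measure-valued autoregressive gamma process M-ARG(1) with base measure `H`
and parameters `(β_t, c_t)_{t ≥ 2}`: given `W_1, …, W_t`, the law of `W_{t+1}` is
`NcGaP(H, β_{t+1} W_t, c_{t+1}⁻¹)`. The values of `W`, `β`, `c` at other indices are irrelevant. -/
structure IsMARG {Ω Θ : Type*} [MeasurableSpace Ω] [MetricSpace Θ] [MeasurableSpace Θ]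
    (P : Measure Ω) (H : Measure Θ) (β c : ℕ → ℝ) (W : ℕ → Ω → Measure Θ) : Prop where
  base_boundedlyFinite : IsBoundedlyFinite H
  beta_pos : ∀ t, 2 ≤ t → 0 < β t
  c_pos : ∀ t, 2 ≤ t → 0 < c t
  measurable : ∀ t, 1 ≤ t → Measurable (W t)
  boundedlyFinite : ∀ t, 1 ≤ t → ∀ᵐ ω ∂P, IsBoundedlyFinite (W t ω)
  transition : ∀ t, 1 ≤ t → ∃ ν : Ω → Measure (Measure Θ),
    IsCondLaw P (pastSigma W t) (W (t + 1)) ν ∧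
      ∀ᵐ ω ∂P, IsNcGammaLaw (ν ω) H (ENNReal.ofReal (β (t + 1)) • W t ω) (c (t + 1))

/-- The intensity measure `κ (∫ K(y, θ) w(dθ)) ℓ(dy)`. -/
noncomputable def shotNoiseIntensity {Θ Y : Type*} [MeasurableSpace Θ] [MeasurableSpace Y]
    (ℓ : Measure Y) (K : Y → Θ → ℝ≥0) (κ : ℝ≥0) (w : Measure Θ) : Measure Y :=
  ℓ.withDensity (fun y => (κ : ℝ≥0∞) * ∫⁻ θ, (K y θ : ℝ≥0∞) ∂w)

/-- `(N_t)_{t ≥ 1}` is a shot noise measure-valued autoregressive gamma process SN-M-ARG(1) driven by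
the M-ARG(1) process `(W_t)_{t ≥ 1}`: conditionally on `(W_t)_{t ≥ 1}`, the `N_t` are independent
Poisson random measures with intensities `Λ_t(dy) = κ_t (∫ K(y, θ) W_t(dθ)) ℓ(dy)`. -/
structure IsSNMARG {Ω Θ Y : Type*} [MeasurableSpace Ω] [MetricSpace Θ] [MeasurableSpace Θ]
    [MeasurableSpace Y] (P : Measure Ω) (H : Measure Θ) (β c : ℕ → ℝ) (W : ℕ → Ω → Measure Θ)
    (ℓ : Measure Y) (K : Y → Θ → ℝ≥0) (κ : ℕ → ℝ≥0) (N : ℕ → Ω → Measure Y) : Prop where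
  isMARG : IsMARG P H β c W
  measurable : ∀ t, 1 ≤ t → Measurable (N t)
  cond_poisson : ∃ ν : ℕ → Ω → Measure (Measure Y),
    (∀ t, 1 ≤ t → IsCondLaw P (fullSigma W) (N t) (ν t) ∧
      ∀ᵐ ω ∂P, IsPoissonLaw (ν t ω) (shotNoiseIntensity ℓ K (κ t) (W t ω))) ∧
    (∀ (T : Finset ℕ), (∀ t ∈ T, 1 ≤ t) → ∀ F : Set Ω, MeasurableSet[fullSigma W] F →
      ∀ A : ℕ → Set (Measure Y), (∀ t, MeasurableSet (A t)) →
        P (F ∩ ⋂ t ∈ T, N t ⁻¹' A t) = ∫⁻ ω in F, ∏ t ∈ T, ν t ω (A t) ∂P)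

/-- The mean measure `A ↦ E (V(A))` of a random measure `V`. -/
noncomputable def meanMeasure {Ω Θ : Type*} [MeasurableSpace Ω] [MeasurableSpace Θ]
    (P : Measure Ω) (V : Ω → Measure Θ) : Measure Θ :=
  P.bind V

/-- `K(A, θ) = ∫_A K(y, θ) ℓ(dy)`. -/
noncomputable def kernelMass {Θ Y : Type*} [MeasurableSpace Y]
    (ℓ : Measure Y) (K : Y → Θ → ℝ≥0) (A : Set Y) (θ : Θ) : ℝ≥0∞ :=
  ∫⁻ y in A, (K y θ : ℝ≥0∞) ∂ℓ

/-- The integrability conditions on the kernel `K`, the base measure `H`, and the initial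
random measure `W₁`. -/
structure IntegrabilityConditions {Ω Θ Y : Type*} [MeasurableSpace Ω] [MeasurableSpace Θ]
    [MetricSpace Y] [MeasurableSpace Y] (P : Measure Ω) (H : Measure Θ) (W₁ : Ω → Measure Θ)
    (ℓ : Measure Y) (K : Y → Θ → ℝ≥0) : Prop where
  h1_kernel : ∀ B : Set Y, Bornology.IsBounded B → MeasurableSet B →
    ∀ θ, ∫⁻ y in B, (K y θ : ℝ≥0∞) ∂ℓ < ∞
  h1_mean : ∀ B : Set Y, Bornology.IsBounded B → MeasurableSet B →
    ∫⁻ y in B, ∫⁻ θ, (K y θ : ℝ≥0∞) ∂(H + meanMeasure P W₁) ∂ℓ < ∞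
  h2 : ∀ B₁ B₂ : Set Y, Bornology.IsBounded B₁ → MeasurableSet B₁ →
    Bornology.IsBounded B₂ → MeasurableSet B₂ →
    ∫⁻ y in B₁ ×ˢ B₂, ∫⁻ θ, (K y.1 θ : ℝ≥0∞) * K y.2 θ ∂(H + meanMeasure P W₁) ∂(ℓ.prod ℓ) < ∞
  h3 : ∀ B₁ B₂ : Set Y, Bornology.IsBounded B₁ → MeasurableSet B₁ →
    Bornology.IsBounded B₂ → MeasurableSet B₂ →
    ∫⁻ ω, ∫⁻ y in B₁ ×ˢ B₂,
      (∫⁻ θ, (K y.1 θ : ℝ≥0∞) ∂(W₁ ω)) * (∫⁻ θ, (K y.2 θ : ℝ≥0∞) ∂(W₁ ω)) ∂(ℓ.prod ℓ) ∂P < ∞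

/-- The quantities in the covariance formula for `B₁`, `B₂` are well defined: the first moments and
the mixed second moments that enter it are finite. -/
structure MomentsWellDefined {Ω Θ Y : Type*} [MeasurableSpace Ω] [MeasurableSpace Θ]
    [MeasurableSpace Y] (P : Measure Ω) (H : Measure Θ) (W₁ : Ω → Measure Θ)
    (ℓ : Measure Y) (K : Y → Θ → ℝ≥0) (B₁ B₂ : Set Y) : Prop where
  mean₁ : ∫⁻ θ, kernelMass ℓ K B₁ θ ∂(H + meanMeasure P W₁) < ∞
  mean₂ : ∫⁻ θ, kernelMass ℓ K B₂ θ ∂(H + meanMeasure P W₁) < ∞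
  mixed : ∫⁻ θ, kernelMass ℓ K B₁ θ * kernelMass ℓ K B₂ θ ∂(H + meanMeasure P W₁) < ∞
  initial : ∫⁻ ω, (∫⁻ θ, kernelMass ℓ K B₁ θ ∂(W₁ ω)) * (∫⁻ θ, kernelMass ℓ K B₂ θ ∂(W₁ ω)) ∂P < ∞

/-- `ρ_{s|t} = ∏_{j=t+1}^{s} β_j c_j` for `s ≥ t`; thus `ρ_{t|t} = 1`. -/
noncomputable def rhoLag (β c : ℕ → ℝ) (s t : ℕ) : ℝ :=
  ∏ j ∈ Finset.Icc (t + 1) s, β j * c j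

/-- `c_{s|t} = c_s + ∑_{j=t+1}^{s-1} c_j ∏_{i=j+1}^{s} β_i c_i` for `s > t`, and `c_{t|t} = 0`. -/
noncomputable def cLag (β c : ℕ → ℝ) (s t : ℕ) : ℝ :=
  if s = t then 0
  else c s + ∑ j ∈ Finset.Ico (t + 1) s, c j * ∏ i ∈ Finset.Icc (j + 1) s, β i * c i

/-- `β_{s|t} = ρ_{s|t} / c_{s|t}` for `s > t`. -/
noncomputable def betaLag (β c : ℕ → ℝ) (s t : ℕ) : ℝ :=
  rhoLag β c s t / cLag β c s t

open Filter Topology Asymptotics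

/-! ### Second order expansions -/

/-! The transition law is known only through its Laplace functional, and moments up to order two are
all that is needed. Along `s ↦ s f` the functional is `exp (-φ s)` with `φ s = s A - s² B + O(s³)`:
integrate `log (1 + x) = x - x²/2 + O(x³)` against `H` and `x / (1 + x) = x - x² + O(x³)` against
`M`. With `u = ∫ f dw` and `v = ∫ g dw`, the quotient `(1 - e^{-su}) / s` lies below `u` and tends
to it as `s ↓ 0`, and the product of the quotients for `u` and `v` combines the Laplace functionals
at `f`, `g` and `f + g`. Fatou's lemma and domination then give the mean `c (H f + M f)` and the
covariance `c² (H(fg) + 2 M(fg))`. Monotone approximation extends both to all measurable functions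
into `[0, ∞]` (`IsNcGammaLaw.lintegral_lintegral`, `IsNcGammaLaw.lintegral_lintegral_mul`).

With `M = β_{t+1} W_t` and `r = β_{t+1} c_{t+1}`, the conditional mean of `W_{t+1}(g)` is the affine
map `c_{t+1} H(g) + r W_t(g)`. Iterating it produces `c_{t|1}` and `ρ_{t|1}`. Equal-time covariances
satisfy `Γ_{t+1} = r² Γ_t + c_{t+1}² H(g₁g₂) + 2 c_{t+1} r E W_t(g₁g₂)`; with the mean formula
inserted, the coefficient of `H(g₁g₂)` stays a perfect square, because `c_{t+1|1} = c_{t+1} + r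
c_{t|1}`. Each further unit of lag only multiplies the covariance by `r`, the constant part being
uncorrelated with the past.

Finally take `g_i = K(B_i, ·)`. Given `W`, counts at distinct times are independent, so their mixed
moment is that of the intensities. At equal times a Poisson measure adds `Λ(B₁ ∩ B₂)`, whence the
last term at `h = 0`. Moments are computed in `ℝ≥0∞`, where no integrability is needed, and moved to
`ℝ` once they are known to be finite. -/

lemma abs_log_one_add_sub_le {x : ℝ} (hx : 0 ≤ x) :
    |Real.log (1 + x) - (x - x ^ 2 / 2)| ≤ 2 * x ^ 3 := by
  have hx3 : 0 ≤ x ^ 3 := by positivity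
  rw [abs_le]
  constructor
  · have h1 := Real.le_log_one_add_of_nonneg hx
    have h2 : x - x ^ 2 / 2 ≤ 2 * x / (x + 2) := by
      rw [le_div_iff₀ (by positivity)]
      nlinarith
    linarith
  -- Beyond `1/2`, `log (1 + x) ≤ x` suffices since `x²/2 ≤ 2 x³`. Below it, the Taylor remainder
  -- `x³ / (1 - x)` is at most `2 x³`.
  · rcases le_or_gt (1 / 2) x with h | h
    · have h1 := Real.log_le_sub_one_of_pos (show 0 < 1 + x by linarith)
      nlinarith [mul_nonneg (sq_nonneg x) (sub_nonneg.2 h)]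
    · have h1 := Real.abs_log_sub_add_sum_range_le (x := -x)
        (by rw [abs_neg, abs_of_nonneg hx]; linarith) 2
      have h2 : |-x| ^ (2 + 1) / (1 - |-x|) ≤ 2 * x ^ 3 := by
        rw [abs_neg, abs_of_nonneg hx, div_le_iff₀ (by linarith)]
        change x ^ 3 ≤ _
        nlinarith [mul_nonneg hx3 (sub_nonneg.2 h.le)]
      have h3 := (abs_le.1 (h1.trans h2)).2
      simp only [Finset.sum_range_succ, Finset.sum_range_zero, sub_neg_eq_add] at h3
      norm_num at h3
      linarith

lemma abs_div_one_add_sub_le {x : ℝ} (hx : 0 ≤ x) :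
    |x / (1 + x) - (x - x ^ 2)| ≤ x ^ 3 := by
  have h : x / (1 + x) - (x - x ^ 2) = x ^ 3 / (1 + x) := by
    field_simp
    ring
  rw [h, abs_of_nonneg (by positivity)]
  exact div_le_self (by positivity) (by linarith)

/-- If `φ s = s A - s² B + O(s³)` at `0+`, then `exp (-φ s) = 1 - s A + s² (B + A²/2) + o(s²)`. -/
lemma tendsto_exp_neg_expansion {φ : ℝ → ℝ} {A B C : ℝ}
    (hφ : ∀ s, 0 ≤ s → |φ s - (s * A - s ^ 2 * B)| ≤ C * s ^ 3) :
    Tendsto (fun s => (Real.exp (-φ s) - 1 + s * A) / s ^ 2) (𝓝[>] 0) (𝓝 (B + A ^ 2 / 2)) := by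
  have hpos : ∀ᶠ s : ℝ in 𝓝[>] 0, 0 < s := self_mem_nhdsWithin
  have hs0 : Tendsto (fun s : ℝ => s) (𝓝[>] 0) (𝓝 0) := tendsto_id.mono_left nhdsWithin_le_nhds
  have h2 : Tendsto (fun s => (φ s - s * A) / s ^ 2) (𝓝[>] 0) (𝓝 (-B)) := by
    have h : Tendsto (fun s => (φ s - s * A) / s ^ 2 - (-B)) (𝓝[>] 0) (𝓝 0) := by
      refine squeeze_zero_norm' (a := fun s => C * s) ?_ (by simpa using hs0.const_mul C)
      filter_upwards [hpos] with s hs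
      have : (φ s - s * A) / s ^ 2 - (-B) = (φ s - (s * A - s ^ 2 * B)) / s ^ 2 := by
        field_simp
        ring
      rw [this, Real.norm_eq_abs, abs_div, abs_of_pos (show 0 < s ^ 2 by positivity),
        div_le_iff₀ (by positivity)]
      calc _ ≤ C * s ^ 3 := hφ s hs.le
        _ = _ := by ring
    simpa using h.add_const (-B)
  have h1 : Tendsto (fun s => φ s / s) (𝓝[>] 0) (𝓝 A) := by
    have h := (h2.mul hs0).add_const A
    simp only [mul_zero, zero_add] at h
    refine h.congr' ?_
    filter_upwards [hpos] with s hs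
    field_simp
    ring
  have h0 : Tendsto φ (𝓝[>] 0) (𝓝 0) := by
    have h := h1.mul hs0
    simp only [mul_zero] at h
    refine h.congr' ?_
    filter_upwards [hpos] with s hs
    field_simp
  -- The Taylor remainder of `exp` is `o(φ²)`, and `φ = O(s)` turns this into `o(s²)`.
  have h3 : Tendsto (fun s => (Real.exp (-φ s) - (1 + -φ s + (-φ s) ^ 2 / 2)) / s ^ 2)
      (𝓝[>] 0) (𝓝 0) := by
    have hn : Tendsto (fun s => -φ s) (𝓝[>] 0) (𝓝 0) := by simpa using h0.neg
    have e := (Real.exp_sub_sum_range_succ_isLittleO_pow 2).comp_tendsto hn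
    have b : (fun s => (-φ s) ^ 2) =O[𝓝[>] 0] fun s => s ^ 2 := by
      refine IsBigO.pow ?_ 2
      refine (IsBigO.neg_left ?_)
      exact isBigO_of_div_tendsto_nhds (by filter_upwards [hpos] with s hs h; exact absurd h hs.ne')
        A h1
    have e2 := (e.trans_isBigO b).tendsto_div_nhds_zero
    refine e2.congr fun s => ?_
    simp [Finset.sum_range_succ]
  have h4 := (h3.sub h2).add ((h1.pow 2).div_const 2)
  have h5 : 0 - -B + A ^ 2 / 2 = B + A ^ 2 / 2 := by ring
  rw [h5] at h4
  refine h4.congr' ?_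
  filter_upwards [hpos] with s hs
  field_simp
  ring

/-! ### Test functions: bounded, with bounded support -/

section BMPlus

variable {Θ : Type*} [MetricSpace Θ] [MeasurableSpace Θ]

lemma IsBMPlus.smul {f : Θ → ℝ} (hf : IsBMPlus f) {s : ℝ} (hs : 0 ≤ s) :
    IsBMPlus (fun θ => s * f θ) where
  measurable := hf.measurable.const_mul s
  nonneg θ := mul_nonneg hs (hf.nonneg θ)
  bounded := by
    obtain ⟨C, hC⟩ := hf.bounded
    exact ⟨s * C, fun x => mul_le_mul_of_nonneg_left (hC x) hs⟩
  bounded_support := hf.bounded_support.subset fun x hx => by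
    rw [Function.mem_support] at hx ⊢
    exact right_ne_zero_of_mul hx

lemma IsBMPlus.add {f g : Θ → ℝ} (hf : IsBMPlus f) (hg : IsBMPlus g) :
    IsBMPlus (fun θ => f θ + g θ) where
  measurable := hf.measurable.add hg.measurable
  nonneg θ := add_nonneg (hf.nonneg θ) (hg.nonneg θ)
  bounded := by
    obtain ⟨C, hC⟩ := hf.bounded
    obtain ⟨D, hD⟩ := hg.bounded
    exact ⟨C + D, fun x => add_le_add (hC x) (hD x)⟩
  bounded_support := (hf.bounded_support.union hg.bounded_support).subset
    (Function.support_add f g)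

lemma IsBMPlus.mul {f g : Θ → ℝ} (hf : IsBMPlus f) (hg : IsBMPlus g) :
    IsBMPlus (fun θ => f θ * g θ) where
  measurable := hf.measurable.mul hg.measurable
  nonneg θ := mul_nonneg (hf.nonneg θ) (hg.nonneg θ)
  bounded := by
    obtain ⟨C, hC⟩ := hf.bounded
    obtain ⟨D, hD⟩ := hg.bounded
    exact ⟨C * D, fun x => mul_le_mul (hC x) (hD x) (hg.nonneg x) ((hf.nonneg x).trans (hC x))⟩
  bounded_support := hf.bounded_support.subset fun x hx => by
    rw [Function.mem_support] at hx ⊢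
    exact left_ne_zero_of_mul hx

lemma IsBMPlus.pow {f : Θ → ℝ} (hf : IsBMPlus f) (n : ℕ) : IsBMPlus (fun θ => f θ ^ (n + 1)) := by
  induction n with
  | zero => simpa using hf
  | succ n ih => simpa only [pow_succ _ (n + 1)] using ih.mul hf

lemma IsBMPlus.integrable {f : Θ → ℝ} (hf : IsBMPlus f) {m : Measure Θ}
    (hm : IsBoundedlyFinite m) : Integrable f m := by
  obtain ⟨C, hC⟩ := hf.bounded
  have hS : MeasurableSet (Function.support f) := measurableSet_support hf.measurable
  rw [← integrableOn_iff_integrable_of_support_subset (s := Function.support f) subset_rfl]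
  exact Measure.integrableOn_of_bounded (M := C) (hm _ hf.bounded_support).ne
    hf.measurable.aestronglyMeasurable
    (ae_of_all _ fun x => by rw [Real.norm_of_nonneg (hf.nonneg x)]; exact hC x)

lemma IsBMPlus.lintegral_eq {f : Θ → ℝ} (hf : IsBMPlus f) {m : Measure Θ}
    (hm : IsBoundedlyFinite m) : ∫⁻ θ, ENNReal.ofReal (f θ) ∂m = ENNReal.ofReal (∫ θ, f θ ∂m) :=
  (ofReal_integral_eq_lintegral_ofReal (hf.integrable hm) (ae_of_all _ hf.nonneg)).symm

/-- The pointwise expansion is integrated; the third moment of `f`, finite for a test function,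
controls the error, and `hle` makes `ψ (s f)` integrable. It serves both `log (1 + x)` (`b = 1/2`)
and `x / (1 + x)` (`b = 1`). -/
lemma IsBMPlus.abs_integral_comp_sub_le {f : Θ → ℝ} (hf : IsBMPlus f) {m : Measure Θ}
    (hm : IsBoundedlyFinite m) {ψ : ℝ → ℝ} (hψ : Measurable ψ) {b C : ℝ}
    (hle : ∀ x, 0 ≤ x → |ψ x| ≤ x)
    (hb : ∀ x, 0 ≤ x → |ψ x - (x - x ^ 2 * b)| ≤ C * x ^ 3) {s : ℝ} (hs : 0 ≤ s) :
    |∫ θ, ψ (s * f θ) ∂m - (s * ∫ θ, f θ ∂m - s ^ 2 * (b * ∫ θ, f θ ^ 2 ∂m))| ≤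
      C * (∫ θ, f θ ^ 3 ∂m) * s ^ 3 := by
  have i1 := hf.integrable hm
  have i2 := (hf.pow 1).integrable hm
  have i3 := (hf.pow 2).integrable hm
  norm_num at i2 i3
  have i0 : Integrable (fun θ => ψ (s * f θ)) m := by
    refine (i1.const_mul s).mono' (hψ.comp (hf.measurable.const_mul s)).aestronglyMeasurable ?_
    exact ae_of_all _ fun θ => hle _ (mul_nonneg hs (hf.nonneg θ))
  have e : ∫ θ, ψ (s * f θ) ∂m - (s * ∫ θ, f θ ∂m - s ^ 2 * (b * ∫ θ, f θ ^ 2 ∂m)) =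
      ∫ θ, (ψ (s * f θ) - (s * f θ - s ^ 2 * b * f θ ^ 2)) ∂m := by
    have i12 : Integrable (fun θ => s * f θ - s ^ 2 * b * f θ ^ 2) m :=
      (i1.const_mul s).sub (i2.const_mul _)
    rw [integral_sub i0 i12, integral_sub (i1.const_mul s) (i2.const_mul _), integral_const_mul, integral_const_mul]
    ring
  rw [e, ← Real.norm_eq_abs]
  refine (norm_integral_le_of_norm_le (i3.const_mul (C * s ^ 3)) (ae_of_all _ fun θ => ?_)).trans
    (le_of_eq ?_)
  · have := hb (s * f θ) (mul_nonneg hs (hf.nonneg θ))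
    rw [Real.norm_eq_abs]
    convert! this using 1
    · congr 1
      ring
    · ring
  · rw [integral_const_mul]
    ring

end BMPlus

/-! ### Moments of noncentral gamma random measures -/

/-- Fatou's lemma gives `≤` and the bound `F i ≤ G` gives `≥`. Integrability of `G` is not
presupposed, so a finite `L` proves that the moment is finite. -/
lemma lintegral_eq_of_tendsto_of_le {α ι : Type*} [MeasurableSpace α] {μ : Measure α}
    {l : Filter ι} [l.IsCountablyGenerated] [l.NeBot] {F : ι → α → ℝ≥0∞} {G : α → ℝ≥0∞} {L : ℝ≥0∞}
    (hF : ∀ i, Measurable (F i)) (hle : ∀ᶠ i in l, ∀ᵐ a ∂μ, F i a ≤ G a)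
    (hlim : ∀ᵐ a ∂μ, Tendsto (fun i => F i a) l (𝓝 (G a)))
    (hL : Tendsto (fun i => ∫⁻ a, F i a ∂μ) l (𝓝 L)) : ∫⁻ a, G a ∂μ = L := by
  apply le_antisymm
  · calc ∫⁻ a, G a ∂μ = ∫⁻ a, liminf (fun i => F i a) l ∂μ := by
          refine lintegral_congr_ae ?_
          filter_upwards [hlim] with a ha using ha.liminf_eq.symm
      _ ≤ liminf (fun i => ∫⁻ a, F i a ∂μ) l := lintegral_liminf_le hF
      _ = L := hL.liminf_eq
  · exact le_of_tendsto hL (hle.mono fun i hi => lintegral_mono_ae hi)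

lemma one_sub_exp_div_le {x s : ℝ} (hs : 0 < s) : (1 - Real.exp (-(s * x))) / s ≤ x := by
  rw [div_le_iff₀ hs]
  linarith [Real.add_one_le_exp (-(s * x))]

lemma one_sub_exp_div_nonneg {x s : ℝ} (hs : 0 < s) (hx : 0 ≤ x) :
    0 ≤ (1 - Real.exp (-(s * x))) / s :=
  div_nonneg (sub_nonneg.2 (Real.exp_le_one_iff.2 (by nlinarith))) hs.le

lemma tendsto_one_sub_exp_div {φ : ℝ → ℝ} {A B C : ℝ}
    (hφ : ∀ s, 0 ≤ s → |φ s - (s * A - s ^ 2 * B)| ≤ C * s ^ 3) :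
    Tendsto (fun s => (1 - Real.exp (-φ s)) / s) (𝓝[>] 0) (𝓝 A) := by
  have hs0 : Tendsto (fun s : ℝ => s) (𝓝[>] 0) (𝓝 0) := tendsto_id.mono_left nhdsWithin_le_nhds
  have h := ((tendsto_exp_neg_expansion hφ).mul hs0).const_sub A
  simp only [mul_zero, sub_zero] at h
  refine h.congr' ?_
  filter_upwards [self_mem_nhdsWithin] with s (hs : 0 < s)
  field_simp
  ring

lemma tendsto_one_sub_exp_mul_div (x : ℝ) :
    Tendsto (fun s => (1 - Real.exp (-(s * x))) / s) (𝓝[>] 0) (𝓝 x) :=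
  tendsto_one_sub_exp_div (B := 0) (C := 0) fun s _ => by simp

/-! ### Moments on test functions, from the Laplace functional -/

section NcGamma

variable {Θ : Type*} [MetricSpace Θ] [MeasurableSpace Θ]

/-- The negative logarithm of the Laplace functional of `NcGaP(H, M, c⁻¹)` along `s ↦ s f`. -/
noncomputable def ncGammaExponent (H M : Measure Θ) (c : ℝ) (f : Θ → ℝ) (s : ℝ) : ℝ :=
  ∫ θ, Real.log (1 + c * (s * f θ)) ∂H + ∫ θ, c * (s * f θ) / (1 + c * (s * f θ)) ∂M

/-- The mean of `∫ f dW` for `W ∼ NcGaP(H, M, c⁻¹)`. -/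
noncomputable def ncGammaMean (H M : Measure Θ) (c : ℝ) (f : Θ → ℝ) : ℝ :=
  c * (∫ θ, f θ ∂H + ∫ θ, f θ ∂M)

/-- Half of the variance of `∫ f dW` for `W ∼ NcGaP(H, M, c⁻¹)`. -/
noncomputable def ncGammaHalfVar (H M : Measure Θ) (c : ℝ) (f : Θ → ℝ) : ℝ :=
  c ^ 2 * ((∫ θ, f θ ^ 2 ∂H) / 2 + ∫ θ, f θ ^ 2 ∂M)

lemma exists_abs_ncGammaExponent_sub_le {H M : Measure Θ} (hH : IsBoundedlyFinite H)
    (hM : IsBoundedlyFinite M) {c : ℝ} (hc : 0 < c) {f : Θ → ℝ} (hf : IsBMPlus f) :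
    ∃ C, ∀ s, 0 ≤ s → |ncGammaExponent H M c f s -
      (s * ncGammaMean H M c f - s ^ 2 * ncGammaHalfVar H M c f)| ≤ C * s ^ 3 := by
  refine ⟨2 * (∫ θ, f θ ^ 3 ∂H) * c ^ 3 + 1 * (∫ θ, f θ ^ 3 ∂M) * c ^ 3, fun s hs => ?_⟩
  have hcs : 0 ≤ c * s := by positivity
  have h1 := hf.abs_integral_comp_sub_le hH (ψ := fun x => Real.log (1 + x)) (b := 1 / 2) (C := 2)
    (Real.measurable_log.comp (measurable_const.add measurable_id))
    (fun x hx => by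
      rw [abs_of_nonneg (Real.log_nonneg (by linarith))]
      linarith [Real.log_le_sub_one_of_pos (show 0 < 1 + x by linarith)])
    (fun x hx => by
      rw [show x - x ^ 2 * (1 / 2) = x - x ^ 2 / 2 by ring]
      exact abs_log_one_add_sub_le hx) hcs
  have h2 := hf.abs_integral_comp_sub_le hM (ψ := fun x => x / (1 + x)) (b := 1) (C := 1)
    (measurable_id.div (measurable_const.add measurable_id))
    (fun x hx => by
      rw [abs_of_nonneg (by positivity)]
      exact div_le_self hx (by linarith))
    (fun x hx => by
      rw [mul_one, one_mul]
      exact abs_div_one_add_sub_le hx) hcs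
  have h3 := (abs_add_le _ _).trans (add_le_add h1 h2)
  simp only [ncGammaExponent, ncGammaMean, ncGammaHalfVar, ← mul_assoc] at h3 ⊢
  convert! h3 using 1
  · congr 1
    ring
  · ring

namespace IsNcGammaLaw

variable {Q : Measure (Measure Θ)} {H M : Measure Θ} {c : ℝ}

/-- The integral against `w` is written as the `toReal` of a lower integral, which is measurable in
`w`; it agrees with the Bochner integral on boundedly finite `w`, hence almost surely. -/
lemma integral_exp (hQ : IsNcGammaLaw Q H M c) {f : Θ → ℝ} (hf : IsBMPlus f) {s : ℝ}
    (hs : 0 ≤ s) :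
    ∫ w, Real.exp (-(s * (∫⁻ θ, ENNReal.ofReal (f θ) ∂w).toReal)) ∂Q =
      Real.exp (-ncGammaExponent H M c f s) := by
  rw [ncGammaExponent, neg_add, ← sub_eq_add_neg, ← hQ.laplace _ (hf.smul hs)]
  refine integral_congr_ae ?_
  filter_upwards [hQ.boundedlyFinite] with w hw
  rw [hf.lintegral_eq hw, ENNReal.toReal_ofReal (integral_nonneg hf.nonneg), integral_const_mul]

lemma measurable_toReal_lintegral {f : Θ → ℝ} (hf : IsBMPlus f) :
    Measurable fun w : Measure Θ => (∫⁻ θ, ENNReal.ofReal (f θ) ∂w).toReal :=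
  (Measure.measurable_lintegral hf.measurable.ennreal_ofReal).ennreal_toReal

lemma integrable_exp (hQ : IsNcGammaLaw Q H M c) {f : Θ → ℝ} (hf : IsBMPlus f) {s : ℝ}
    (hs : 0 ≤ s) :
    Integrable (fun w => Real.exp (-(s * (∫⁻ θ, ENNReal.ofReal (f θ) ∂w).toReal))) Q := by
  have := hQ.isProbabilityMeasure
  refine Integrable.of_bound (C := 1)
    (((measurable_toReal_lintegral hf).const_mul s).neg.exp).aestronglyMeasurable
    (ae_of_all _ fun w => ?_)
  rw [Real.norm_of_nonneg (Real.exp_nonneg _), Real.exp_le_one_iff, neg_nonpos]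
  exact mul_nonneg hs ENNReal.toReal_nonneg

lemma lintegral_ofReal (hQ : IsNcGammaLaw Q H M c) (hH : IsBoundedlyFinite H)
    (hM : IsBoundedlyFinite M) (hc : 0 < c) {f : Θ → ℝ} (hf : IsBMPlus f) :
    ∫⁻ w, ∫⁻ θ, ENNReal.ofReal (f θ) ∂w ∂Q = ENNReal.ofReal (ncGammaMean H M c f) := by
  have := hQ.isProbabilityMeasure
  obtain ⟨C, hC⟩ := exists_abs_ncGammaExponent_sub_le hH hM hc hf
  set u : Measure Θ → ℝ := fun w => (∫⁻ θ, ENNReal.ofReal (f θ) ∂w).toReal with hu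
  have hum : Measurable u := measurable_toReal_lintegral hf
  have hu0 : ∀ w, 0 ≤ u w := fun w => ENNReal.toReal_nonneg
  have huE : ∀ᵐ w ∂Q, ∫⁻ θ, ENNReal.ofReal (f θ) ∂w = ENNReal.ofReal (u w) := by
    filter_upwards [hQ.boundedlyFinite] with w hw
    rw [hu, ENNReal.ofReal_toReal]
    rw [hf.lintegral_eq hw]
    exact ENNReal.ofReal_ne_top
  rw [lintegral_congr_ae huE]
  refine lintegral_eq_of_tendsto_of_le (l := 𝓝[>] (0 : ℝ))
    (F := fun s w => ENNReal.ofReal ((1 - Real.exp (-(s * u w))) / s)) (fun s => ?_) ?_ ?_ ?_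
  · fun_prop
  · filter_upwards [self_mem_nhdsWithin] with s (hs : 0 < s)
    exact ae_of_all _ fun w => ENNReal.ofReal_le_ofReal (one_sub_exp_div_le hs)
  · exact ae_of_all _ fun w => ENNReal.tendsto_ofReal (tendsto_one_sub_exp_mul_div _)
  · refine (ENNReal.tendsto_ofReal (tendsto_one_sub_exp_div hC)).congr' ?_
    filter_upwards [self_mem_nhdsWithin] with s (hs : 0 < s)
    have hi := hQ.integrable_exp hf hs.le
    have hi' : Integrable (fun w => (1 - Real.exp (-(s * u w))) / s) Q :=
      ((integrable_const 1).sub hi).div_const s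
    rw [← ofReal_integral_eq_lintegral_ofReal hi'
      (ae_of_all _ fun w => one_sub_exp_div_nonneg hs (hu0 w)), integral_div,
      integral_sub (integrable_const 1) hi, hQ.integral_exp hf hs.le]
    simp

/-- Polarization: `(1 - e^{-su})(1 - e^{-sv}) = 1 - e^{-su} - e^{-sv} + e^{-s(u+v)}`. In the
expansion for `f + g` minus those for `f` and `g`, the linear terms cancel and the cross terms of `B
+ A²/2` remain. -/
lemma lintegral_ofReal_mul (hQ : IsNcGammaLaw Q H M c) (hH : IsBoundedlyFinite H)
    (hM : IsBoundedlyFinite M) (hc : 0 < c) {f g : Θ → ℝ} (hf : IsBMPlus f) (hg : IsBMPlus g) :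
    ∫⁻ w, (∫⁻ θ, ENNReal.ofReal (f θ) ∂w) * (∫⁻ θ, ENNReal.ofReal (g θ) ∂w) ∂Q =
      ENNReal.ofReal (ncGammaMean H M c f * ncGammaMean H M c g +
        c ^ 2 * (∫ θ, f θ * g θ ∂H + 2 * ∫ θ, f θ * g θ ∂M)) := by
  have := hQ.isProbabilityMeasure
  obtain ⟨C, hC⟩ := exists_abs_ncGammaExponent_sub_le hH hM hc hf
  obtain ⟨D, hD⟩ := exists_abs_ncGammaExponent_sub_le hH hM hc hg
  obtain ⟨E, hE⟩ := exists_abs_ncGammaExponent_sub_le hH hM hc (hf.add hg)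
  set u : Measure Θ → ℝ := fun w => (∫⁻ θ, ENNReal.ofReal (f θ) ∂w).toReal with hu
  set v : Measure Θ → ℝ := fun w => (∫⁻ θ, ENNReal.ofReal (g θ) ∂w).toReal with hv
  have hum : Measurable u := measurable_toReal_lintegral hf
  have hvm : Measurable v := measurable_toReal_lintegral hg
  have hu0 : ∀ w, 0 ≤ u w := fun w => ENNReal.toReal_nonneg
  have hv0 : ∀ w, 0 ≤ v w := fun w => ENNReal.toReal_nonneg
  have huE : ∀ᵐ w ∂Q, (∫⁻ θ, ENNReal.ofReal (f θ) ∂w) * (∫⁻ θ, ENNReal.ofReal (g θ) ∂w) =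
      ENNReal.ofReal (u w * v w) := by
    filter_upwards [hQ.boundedlyFinite] with w hw
    rw [ENNReal.ofReal_mul (hu0 w), hu, hv, ENNReal.ofReal_toReal, ENNReal.ofReal_toReal]
    · rw [hg.lintegral_eq hw]
      exact ENNReal.ofReal_ne_top
    · rw [hf.lintegral_eq hw]
      exact ENNReal.ofReal_ne_top
  have huv : ∀ᵐ w ∂Q, (∫⁻ θ, ENNReal.ofReal (f θ + g θ) ∂w).toReal = u w + v w := by
    filter_upwards [hQ.boundedlyFinite] with w hw
    rw [hu, hv, (hf.add hg).lintegral_eq hw]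
    simp only [hf.lintegral_eq hw, hg.lintegral_eq hw]
    rw [ENNReal.toReal_ofReal (integral_nonneg hf.nonneg),
      ENNReal.toReal_ofReal (integral_nonneg hg.nonneg),
      ENNReal.toReal_ofReal (integral_nonneg (hf.add hg).nonneg),
      integral_add (hf.integrable hw) (hg.integrable hw)]
  rw [lintegral_congr_ae huE]
  refine lintegral_eq_of_tendsto_of_le (l := 𝓝[>] (0 : ℝ))
    (F := fun s w => ENNReal.ofReal ((1 - Real.exp (-(s * u w))) / s *
      ((1 - Real.exp (-(s * v w))) / s))) (fun s => ?_) ?_ ?_ ?_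
  · fun_prop
  · filter_upwards [self_mem_nhdsWithin] with s (hs : 0 < s)
    exact ae_of_all _ fun w => ENNReal.ofReal_le_ofReal (mul_le_mul (one_sub_exp_div_le hs)
      (one_sub_exp_div_le hs) (one_sub_exp_div_nonneg hs (hv0 w)) (hu0 w))
  · exact ae_of_all _ fun w => ENNReal.tendsto_ofReal
      ((tendsto_one_sub_exp_mul_div _).mul (tendsto_one_sub_exp_mul_div _))
  · have hmean : ncGammaMean H M c (fun θ => f θ + g θ) =
        ncGammaMean H M c f + ncGammaMean H M c g := by
      simp only [ncGammaMean]
      rw [integral_add (hf.integrable hH) (hg.integrable hH),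
        integral_add (hf.integrable hM) (hg.integrable hM)]
      ring
    have hsq : ∀ {m : Measure Θ}, IsBoundedlyFinite m → ∫ θ, (f θ + g θ) ^ 2 ∂m =
        ∫ θ, f θ ^ 2 ∂m + 2 * ∫ θ, f θ * g θ ∂m + ∫ θ, g θ ^ 2 ∂m := by
      intro m hm
      have i1 : Integrable (fun θ => f θ ^ 2) m := (hf.pow 1).integrable hm
      have i2 : Integrable (fun θ => g θ ^ 2) m := (hg.pow 1).integrable hm
      have i3 : Integrable (fun θ => 2 * (f θ * g θ)) m :=
        ((hf.mul hg).integrable hm).const_mul 2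
      have i13 : Integrable (fun θ => f θ ^ 2 + 2 * (f θ * g θ)) m := i1.add i3
      rw [← integral_const_mul, ← integral_add i1 i3, ← integral_add i13 i2]
      congr 1 with θ
      ring
    have hvar : ncGammaHalfVar H M c (fun θ => f θ + g θ) =
        ncGammaHalfVar H M c f + ncGammaHalfVar H M c g +
          c ^ 2 * (∫ θ, f θ * g θ ∂H + 2 * ∫ θ, f θ * g θ ∂M) := by
      simp only [ncGammaHalfVar, hsq hH, hsq hM]
      ring
    have hlim := ((tendsto_exp_neg_expansion hE).sub (tendsto_exp_neg_expansion hC)).sub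
      (tendsto_exp_neg_expansion hD)
    rw [hmean, hvar] at hlim
    have hval : ncGammaMean H M c f * ncGammaMean H M c g +
        c ^ 2 * (∫ θ, f θ * g θ ∂H + 2 * ∫ θ, f θ * g θ ∂M) =
        ncGammaHalfVar H M c f + ncGammaHalfVar H M c g +
          c ^ 2 * (∫ θ, f θ * g θ ∂H + 2 * ∫ θ, f θ * g θ ∂M) +
          (ncGammaMean H M c f + ncGammaMean H M c g) ^ 2 / 2 -
        (ncGammaHalfVar H M c f + ncGammaMean H M c f ^ 2 / 2) -
        (ncGammaHalfVar H M c g + ncGammaMean H M c g ^ 2 / 2) := by ring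
    rw [hval]
    refine (ENNReal.tendsto_ofReal hlim).congr' ?_
    filter_upwards [self_mem_nhdsWithin] with s (hs : 0 < s)
    have hif := hQ.integrable_exp hf hs.le
    have hig := hQ.integrable_exp hg hs.le
    have hifg := hQ.integrable_exp (hf.add hg) hs.le
    have hpt : (fun w => (1 - Real.exp (-(s * u w))) / s * ((1 - Real.exp (-(s * v w))) / s))
        =ᵐ[Q] fun w => (1 - Real.exp (-(s * u w)) - Real.exp (-(s * v w)) +
          Real.exp (-(s * (∫⁻ θ, ENNReal.ofReal (f θ + g θ) ∂w).toReal))) / s ^ 2 := by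
      filter_upwards [huv] with w hw
      rw [hw, mul_add, neg_add, Real.exp_add]
      field_simp
      ring
    have hint := ((((integrable_const (1 : ℝ)).sub hif).sub hig).add hifg).div_const (s ^ 2)
    have hpt' : Integrable
        (fun w => (1 - Real.exp (-(s * u w))) / s * ((1 - Real.exp (-(s * v w))) / s)) Q :=
      hint.congr hpt.symm
    rw [← ofReal_integral_eq_lintegral_ofReal hpt' (ae_of_all _ fun w =>
      mul_nonneg (one_sub_exp_div_nonneg hs (hu0 w)) (one_sub_exp_div_nonneg hs (hv0 w))),
      integral_congr_ae hpt, integral_div]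
    have hsum : ∫ w, (1 - Real.exp (-(s * u w)) - Real.exp (-(s * v w)) +
          Real.exp (-(s * (∫⁻ θ, ENNReal.ofReal (f θ + g θ) ∂w).toReal))) ∂Q =
        1 - Real.exp (-ncGammaExponent H M c f s) - Real.exp (-ncGammaExponent H M c g s) +
          Real.exp (-ncGammaExponent H M c (fun θ => f θ + g θ) s) := by
      rw [← hQ.integral_exp hf hs.le, ← hQ.integral_exp hg hs.le,
        ← hQ.integral_exp (hf.add hg) hs.le]
      have j1 : Integrable (fun w => 1 - Real.exp (-(s * u w))) Q :=
        (integrable_const (1 : ℝ)).sub hif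
      have j2 : Integrable (fun w => 1 - Real.exp (-(s * u w)) - Real.exp (-(s * v w))) Q :=
        j1.sub hig
      rw [integral_add j2 hifg, integral_sub j1 hig, integral_sub (integrable_const 1) hif]
      simp
    rw [hsum]
    congr 1
    field_simp
    ring

end IsNcGammaLaw

end NcGamma

lemma ENNReal.iSup_mul_iSup_of_monotone {f g : ℕ → ℝ≥0∞} (hf : Monotone f) (hg : Monotone g) :
    (⨆ n, f n) * (⨆ n, g n) = ⨆ n, f n * g n := by
  apply le_antisymm
  · rw [ENNReal.iSup_mul]
    refine iSup_le fun m => ?_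
    rw [ENNReal.mul_iSup]
    refine iSup_le fun n => ?_
    exact le_iSup_of_le (max m n)
      (mul_le_mul' (hf (le_max_left m n)) (hg (le_max_right m n)))
  · exact iSup_le fun n => mul_le_mul' (le_iSup f n) (le_iSup g n)

lemma ENNReal.mul_iSup_add_iSup_of_monotone (a : ℝ≥0∞) {f g : ℕ → ℝ≥0∞} (hf : Monotone f)
    (hg : Monotone g) : a * ((⨆ n, f n) + ⨆ n, g n) = ⨆ n, a * (f n + g n) := by
  rw [ENNReal.iSup_add_iSup_of_monotone hf hg, ENNReal.mul_iSup]

/-! ### Extension of the moments to measurable functions into `[0, ∞]` -/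

section Approximation

variable {Θ : Type*} [MetricSpace Θ] [MeasurableSpace Θ]

/-- Truncate `g` at height `n` and restrict it to the ball of radius `n` about a fixed point. -/
lemma exists_isBMPlus_iSup_eq [OpensMeasurableSpace Θ] {g : Θ → ℝ≥0∞} (hg : Measurable g) :
    ∃ f : ℕ → Θ → ℝ, (∀ n, IsBMPlus (f n)) ∧ (Monotone fun n θ => ENNReal.ofReal (f n θ)) ∧
      ∀ θ, ⨆ n, ENNReal.ofReal (f n θ) = g θ := by
  rcases isEmpty_or_nonempty Θ with h | ⟨⟨x₀⟩⟩
  · exact ⟨fun _ _ => 0, fun n => ⟨measurable_const, fun x => le_rfl, ⟨0, fun x => le_rfl⟩,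
      by simp⟩, monotone_const, fun θ => h.elim θ⟩
  have hfin : ∀ (n : ℕ) (θ : Θ), min (g θ) n ≠ ∞ := fun n θ =>
    ((min_le_right _ _).trans_lt (ENNReal.natCast_lt_top n)).ne
  have hof : ∀ (n : ℕ) (θ : Θ), ENNReal.ofReal ((Metric.ball x₀ n).indicator
      (fun θ => (min (g θ) n).toReal) θ) = (Metric.ball x₀ n).indicator
      (fun θ => min (g θ) n) θ := fun n θ => by
    by_cases h : θ ∈ Metric.ball x₀ n
    · rw [Set.indicator_of_mem h, Set.indicator_of_mem h, ENNReal.ofReal_toReal (hfin n θ)]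
    · rw [Set.indicator_of_notMem h, Set.indicator_of_notMem h, ENNReal.ofReal_zero]
  have hmono : Monotone fun (n : ℕ) θ => (Metric.ball x₀ n).indicator (fun θ => min (g θ) n) θ := by
    intro m n hmn θ
    have hmn' : (m : ℝ≥0∞) ≤ n := by exact_mod_cast hmn
    refine (Set.indicator_le_indicator_of_subset
      (Metric.ball_subset_ball (Nat.cast_le.2 hmn)) (fun _ => zero_le) θ).trans ?_
    exact Set.indicator_le_indicator (min_le_min_left _ hmn')
  refine ⟨fun n => (Metric.ball x₀ n).indicator (fun θ => (min (g θ) n).toReal),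
    fun n => ⟨?_, ?_, ⟨n, ?_⟩, ?_⟩, ?_, fun θ => ?_⟩
  · exact (hg.min measurable_const).ennreal_toReal.indicator measurableSet_ball
  · exact fun θ => Set.indicator_nonneg (fun _ _ => ENNReal.toReal_nonneg) θ
  · refine fun θ => Set.indicator_le' (fun _ _ => ?_) (fun _ _ => Nat.cast_nonneg n) θ
    exact ENNReal.toReal_le_of_le_ofReal (Nat.cast_nonneg n) (by simp)
  · exact Metric.isBounded_ball.subset Set.support_indicator_subset
  · simpa only [hof] using hmono
  · simp only [hof]
    refine iSup_eq_of_tendsto (fun m n h => hmono h θ) ?_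
    have h1 : Tendsto (fun n : ℕ => min (g θ) (n : ℝ≥0∞)) atTop (𝓝 (g θ)) := by
      simpa using (tendsto_const_nhds (x := g θ)).min ENNReal.tendsto_nat_nhds_top
    refine h1.congr' ?_
    obtain ⟨N, hN⟩ := exists_nat_gt (dist θ x₀)
    filter_upwards [eventually_ge_atTop N] with n hn
    rw [Set.indicator_of_mem]
    exact Metric.mem_ball.2 (hN.trans_le (by exact_mod_cast hn))

lemma lintegral_eq_iSup_of_monotone {f : ℕ → Θ → ℝ} (hf : ∀ n, IsBMPlus (f n))
    (hmono : Monotone fun n θ => ENNReal.ofReal (f n θ)) {g : Θ → ℝ≥0∞}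
    (hg : ∀ θ, ⨆ n, ENNReal.ofReal (f n θ) = g θ) (m : Measure Θ) :
    ∫⁻ θ, g θ ∂m = ⨆ n, ∫⁻ θ, ENNReal.ofReal (f n θ) ∂m := by
  rw [← lintegral_iSup (fun n => (hf n).measurable.ennreal_ofReal) hmono]
  exact lintegral_congr fun θ => (hg θ).symm

namespace IsNcGammaLaw

variable {Q : Measure (Measure Θ)} {H M : Measure Θ} {c : ℝ}

lemma ofReal_ncGammaMean (hH : IsBoundedlyFinite H)
    (hM : IsBoundedlyFinite M) (hc : 0 < c) {f : Θ → ℝ} (hf : IsBMPlus f) :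
    ENNReal.ofReal (ncGammaMean H M c f) = ENNReal.ofReal c *
      (∫⁻ θ, ENNReal.ofReal (f θ) ∂H + ∫⁻ θ, ENNReal.ofReal (f θ) ∂M) := by
  rw [ncGammaMean, ENNReal.ofReal_mul hc.le, ENNReal.ofReal_add (integral_nonneg hf.nonneg)
    (integral_nonneg hf.nonneg), hf.lintegral_eq hH, hf.lintegral_eq hM]

/-- First moment of a noncentral gamma random measure. -/
theorem lintegral_lintegral [OpensMeasurableSpace Θ] (hQ : IsNcGammaLaw Q H M c) (hH : IsBoundedlyFinite H)
    (hM : IsBoundedlyFinite M) (hc : 0 < c)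
    {g : Θ → ℝ≥0∞} (hg : Measurable g) :
    ∫⁻ w, ∫⁻ θ, g θ ∂w ∂Q = ENNReal.ofReal c * (∫⁻ θ, g θ ∂H + ∫⁻ θ, g θ ∂M) := by
  obtain ⟨f, hf, hmono, hsup⟩ := exists_isBMPlus_iSup_eq hg
  simp only [lintegral_eq_iSup_of_monotone hf hmono hsup]
  have hm : ∀ m : Measure Θ, Monotone fun n => ∫⁻ θ, ENNReal.ofReal (f n θ) ∂m :=
    fun m i j hij => lintegral_mono (hmono hij)
  rw [lintegral_iSup (fun n => Measure.measurable_lintegral (hf n).measurable.ennreal_ofReal)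
    (fun i j hij w => hm w hij), ENNReal.iSup_add_iSup_of_monotone (hm H) (hm M), ENNReal.mul_iSup]
  exact iSup_congr fun n => by
    rw [hQ.lintegral_ofReal hH hM hc (hf n), ofReal_ncGammaMean hH hM hc (hf n)]

/-- Mixed second moment of a noncentral gamma random measure. -/
theorem lintegral_lintegral_mul [OpensMeasurableSpace Θ] (hQ : IsNcGammaLaw Q H M c) (hH : IsBoundedlyFinite H)
    (hM : IsBoundedlyFinite M) (hc : 0 < c)
    {g₁ g₂ : Θ → ℝ≥0∞} (hg₁ : Measurable g₁)
    (hg₂ : Measurable g₂) :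
    ∫⁻ w, (∫⁻ θ, g₁ θ ∂w) * (∫⁻ θ, g₂ θ ∂w) ∂Q =
      (ENNReal.ofReal c * (∫⁻ θ, g₁ θ ∂H + ∫⁻ θ, g₁ θ ∂M)) *
        (ENNReal.ofReal c * (∫⁻ θ, g₂ θ ∂H + ∫⁻ θ, g₂ θ ∂M)) +
      ENNReal.ofReal c ^ 2 * (∫⁻ θ, g₁ θ * g₂ θ ∂H + 2 * ∫⁻ θ, g₁ θ * g₂ θ ∂M) := by
  obtain ⟨f₁, hf₁, hmono₁, hsup₁⟩ := exists_isBMPlus_iSup_eq hg₁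
  obtain ⟨f₂, hf₂, hmono₂, hsup₂⟩ := exists_isBMPlus_iSup_eq hg₂
  have hofm : ∀ n θ, ENNReal.ofReal (f₁ n θ * f₂ n θ) =
      ENNReal.ofReal (f₁ n θ) * ENNReal.ofReal (f₂ n θ) := fun n θ =>
    ENNReal.ofReal_mul ((hf₁ n).nonneg θ)
  have hmono₁₂ : Monotone fun n θ => ENNReal.ofReal (f₁ n θ * f₂ n θ) := fun i j hij θ => by
    simp only [hofm]
    exact mul_le_mul' (hmono₁ hij θ) (hmono₂ hij θ)
  have hsup₁₂ : ∀ θ, ⨆ n, ENNReal.ofReal (f₁ n θ * f₂ n θ) = g₁ θ * g₂ θ := fun θ => by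
    simp only [hofm]
    rw [← ENNReal.iSup_mul_iSup_of_monotone (fun i j hij => hmono₁ hij θ)
      (fun i j hij => hmono₂ hij θ), hsup₁, hsup₂]
  have hf₁₂ : ∀ n, IsBMPlus fun θ => f₁ n θ * f₂ n θ := fun n => (hf₁ n).mul (hf₂ n)
  have e₁₂ := lintegral_eq_iSup_of_monotone hf₁₂ hmono₁₂ hsup₁₂
  simp only [lintegral_eq_iSup_of_monotone hf₁ hmono₁ hsup₁,
    lintegral_eq_iSup_of_monotone hf₂ hmono₂ hsup₂, e₁₂]
  have hm₁ : ∀ m : Measure Θ, Monotone fun n => ∫⁻ θ, ENNReal.ofReal (f₁ n θ) ∂m :=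
    fun m i j hij => lintegral_mono (hmono₁ hij)
  have hm₂ : ∀ m : Measure Θ, Monotone fun n => ∫⁻ θ, ENNReal.ofReal (f₂ n θ) ∂m :=
    fun m i j hij => lintegral_mono (hmono₂ hij)
  have hm₁₂ : ∀ m : Measure Θ, Monotone fun n => ∫⁻ θ, ENNReal.ofReal (f₁ n θ * f₂ n θ) ∂m :=
    fun m i j hij => lintegral_mono (hmono₁₂ hij)
  simp only [ENNReal.iSup_mul_iSup_of_monotone (hm₁ _) (hm₂ _)]
  have hmeas : ∀ n, Measurable fun w : Measure Θ =>
      (∫⁻ θ, ENNReal.ofReal (f₁ n θ) ∂w) * ∫⁻ θ, ENNReal.ofReal (f₂ n θ) ∂w := fun n =>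
    (Measure.measurable_lintegral (hf₁ n).measurable.ennreal_ofReal).mul
      (Measure.measurable_lintegral (hf₂ n).measurable.ennreal_ofReal)
  -- For nondecreasing sequences, suprema commute with sums, products and integrals, so both sides
  -- become suprema of the identity for the test functions `f₁ n` and `f₂ n`.
  rw [lintegral_iSup hmeas (fun i j hij w => mul_le_mul' (hm₁ w hij) (hm₂ w hij)),
    ENNReal.mul_iSup 2, ENNReal.mul_iSup_add_iSup_of_monotone _ (hm₁ H) (hm₁ M),
    ENNReal.mul_iSup_add_iSup_of_monotone _ (hm₂ H) (hm₂ M),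
    ENNReal.mul_iSup_add_iSup_of_monotone _ (hm₁₂ H) ((hm₁₂ M).const_mul' 2),
    ENNReal.iSup_mul_iSup_of_monotone (((hm₁ H).add (hm₁ M)).const_mul' _)
      (((hm₂ H).add (hm₂ M)).const_mul' _),
    ENNReal.iSup_add_iSup_of_monotone
      ((((hm₁ H).add (hm₁ M)).const_mul' _).mul' (((hm₂ H).add (hm₂ M)).const_mul' _))
      (((hm₁₂ H).add ((hm₁₂ M).const_mul' 2)).const_mul' _)]
  refine iSup_congr fun n => ?_
  have n1 : 0 ≤ ncGammaMean H M c (f₁ n) :=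
    mul_nonneg hc.le (add_nonneg (integral_nonneg (hf₁ n).nonneg) (integral_nonneg (hf₁ n).nonneg))
  have n2 : 0 ≤ ncGammaMean H M c (f₂ n) :=
    mul_nonneg hc.le (add_nonneg (integral_nonneg (hf₂ n).nonneg) (integral_nonneg (hf₂ n).nonneg))
  have nH : 0 ≤ ∫ θ, f₁ n θ * f₂ n θ ∂H := integral_nonneg (hf₁₂ n).nonneg
  have nM : 0 ≤ ∫ θ, f₁ n θ * f₂ n θ ∂M := integral_nonneg (hf₁₂ n).nonneg
  rw [hQ.lintegral_ofReal_mul hH hM hc (hf₁ n) (hf₂ n), ENNReal.ofReal_add (mul_nonneg n1 n2)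
    (by positivity), ENNReal.ofReal_mul n1, ofReal_ncGammaMean hH hM hc (hf₁ n),
    ofReal_ncGammaMean hH hM hc (hf₂ n), ENNReal.ofReal_mul (by positivity),
    ENNReal.ofReal_add nH (by positivity), ENNReal.ofReal_mul zero_le_two,
    (hf₁₂ n).lintegral_eq hH, (hf₁₂ n).lintegral_eq hM, ENNReal.ofReal_pow hc.le,
    ENNReal.ofReal_ofNat]

end IsNcGammaLaw

end Approximation

/-! ### Conditional laws -/

/-- The defining property says that the law of `X` under `P` restricted to `F` is the mixture of the
`ν ω` over `F`; two equal measures integrate `Φ` alike. -/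
lemma IsCondLaw.setLIntegral_comp_eq {Ω E : Type*} {m : MeasurableSpace Ω}
    [mΩ : MeasurableSpace Ω] [MeasurableSpace E] {P : Measure Ω} {X : Ω → E} {ν : Ω → Measure E}
    (h : IsCondLaw P m X ν) (hm : m ≤ mΩ) (hX : Measurable X) {F : Set Ω}
    (hF : MeasurableSet[m] F) {Φ : E → ℝ≥0∞} (hΦ : Measurable Φ) :
    ∫⁻ ω in F, Φ (X ω) ∂P = ∫⁻ ω in F, ∫⁻ x, Φ x ∂ν ω ∂P := by
  have hν : Measurable ν := h.measurable.mono hm le_rfl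
  have e : (P.restrict F).map X = (P.restrict F).bind ν := by
    ext A hA
    rw [Measure.map_apply hX hA, Measure.restrict_apply (hX hA), Set.inter_comm,
      h.setLIntegral_eq F hF A hA, Measure.bind_apply hA hν.aemeasurable]
  rw [← lintegral_map hΦ hX, e, Measure.lintegral_bind hν.aemeasurable hΦ.aemeasurable]

/-- The disintegration formula for a regular conditional law. -/
lemma IsCondLaw.lintegral_mul_comp_eq {Ω E : Type*} {m : MeasurableSpace Ω}
    [mΩ : MeasurableSpace Ω] [MeasurableSpace E] {P : Measure Ω} {X : Ω → E} {ν : Ω → Measure E}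
    (h : IsCondLaw P m X ν) (hm : m ≤ mΩ) (hX : Measurable X) {G : Ω → ℝ≥0∞}
    (hG : Measurable[m] G) {Φ : E → ℝ≥0∞} (hΦ : Measurable Φ) :
    ∫⁻ ω, G ω * Φ (X ω) ∂P = ∫⁻ ω, G ω * ∫⁻ x, Φ x ∂ν ω ∂P := by
  have hν : Measurable ν := h.measurable.mono hm le_rfl
  have h1 : Measurable fun ω => Φ (X ω) := hΦ.comp hX
  have h2 : Measurable fun ω => ∫⁻ x, Φ x ∂ν ω := (Measure.measurable_lintegral hΦ).comp hν
  refine @Measurable.ennreal_induction Ω m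
    (fun G => ∫⁻ ω, G ω * Φ (X ω) ∂P = ∫⁻ ω, G ω * ∫⁻ x, Φ x ∂ν ω ∂P) ?_ ?_ ?_ G hG
  · intro a F hF
    have hF' : MeasurableSet F := hm F hF
    have e : ∀ k : Ω → ℝ≥0∞, (fun ω => F.indicator (fun _ => a) ω * k ω) =
        F.indicator fun ω => a * k ω := fun k => by
      ext ω
      by_cases hω : ω ∈ F <;> simp [hω]
    rw [e, e, lintegral_indicator hF', lintegral_indicator hF', lintegral_const_mul _ h1,
      lintegral_const_mul _ h2, h.setLIntegral_comp_eq hm hX hF hΦ]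
  · intro f g _ hf hg ef eg
    have hf' : Measurable f := hf.mono hm le_rfl
    have k1 : Measurable fun ω => f ω * Φ (X ω) := hf'.mul h1
    have k2 : Measurable fun ω => f ω * ∫⁻ x, Φ x ∂ν ω := hf'.mul h2
    simp only [Pi.add_apply, add_mul]
    rw [lintegral_add_left k1, lintegral_add_left k2, ef, eg]
  · intro f hf hmono ef
    have k1 : ∀ n, Measurable fun ω => f n ω * Φ (X ω) := fun n =>
      ((hf n).mono hm le_rfl).mul h1
    have k2 : ∀ n, Measurable fun ω => f n ω * ∫⁻ x, Φ x ∂ν ω := fun n =>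
      ((hf n).mono hm le_rfl).mul h2
    simp only [ENNReal.iSup_mul]
    rw [lintegral_iSup k1 (fun i j hij ω => mul_le_mul_left (hmono hij ω) _),
      lintegral_iSup k2 (fun i j hij ω => mul_le_mul_left (hmono hij ω) _)]
    exact iSup_congr ef

/-! ### Lag coefficients -/

section Lag

variable (β c : ℕ → ℝ)

lemma rhoLag_self (t : ℕ) : rhoLag β c t t = 1 := by
  simp [rhoLag]

lemma rhoLag_succ {s t : ℕ} (h : t ≤ s) :
    rhoLag β c (s + 1) t = β (s + 1) * c (s + 1) * rhoLag β c s t := by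
  rw [rhoLag, rhoLag, Finset.prod_Icc_succ_top (by omega), mul_comm]

lemma cLag_self (t : ℕ) : cLag β c t t = 0 := by
  simp [cLag]

/-- This recursion is the one obeyed by the conditional means. Multiplication by `β (s + 1) * c (s +
1)` turns the leading `c s` into the new summand `j = s`; at `s = t` the convention `c_{t|t} = 0`
matches the empty sum. -/
lemma cLag_succ {s t : ℕ} (h : t ≤ s) :
    cLag β c (s + 1) t = c (s + 1) + β (s + 1) * c (s + 1) * cLag β c s t := by
  rcases h.eq_or_lt with rfl | h
  · simp [cLag]
  · rw [cLag, cLag, if_neg (by omega), if_neg (by omega), Finset.sum_Ico_succ_top (by omega),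
      Finset.Icc_self, Finset.prod_singleton, mul_add, Finset.mul_sum]
    have e : ∀ j ∈ Finset.Ico (t + 1) s, c j * ∏ i ∈ Finset.Icc (j + 1) (s + 1), β i * c i =
        β (s + 1) * c (s + 1) * (c j * ∏ i ∈ Finset.Icc (j + 1) s, β i * c i) := by
      intro j hj
      rw [Finset.mem_Ico] at hj
      rw [Finset.prod_Icc_succ_top (by omega)]
      ring
    rw [Finset.sum_congr rfl e]
    ring

variable {β c}

lemma rhoLag_pos (hβ : ∀ t, 2 ≤ t → 0 < β t) (hc : ∀ t, 2 ≤ t → 0 < c t) {s t : ℕ} (ht : 1 ≤ t) :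
    0 < rhoLag β c s t := by
  refine Finset.prod_pos fun j hj => ?_
  rw [Finset.mem_Icc] at hj
  exact mul_pos (hβ j (by omega)) (hc j (by omega))

lemma cLag_nonneg (hβ : ∀ t, 2 ≤ t → 0 < β t) (hc : ∀ t, 2 ≤ t → 0 < c t) {s t : ℕ} (ht : 1 ≤ t)
    (hst : t ≤ s) : 0 ≤ cLag β c s t := by
  induction s, hst using Nat.le_induction with
  | base => simp [cLag_self]
  | succ s hs ih =>
    rw [cLag_succ β c hs]
    have := hβ (s + 1) (by omega)
    have := hc (s + 1) (by omega)
    positivity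

lemma cLag_pos (hβ : ∀ t, 2 ≤ t → 0 < β t) (hc : ∀ t, 2 ≤ t → 0 < c t) {s t : ℕ} (ht : 1 ≤ t)
    (hst : t < s) : 0 < cLag β c s t := by
  obtain ⟨s, rfl⟩ : ∃ r, s = r + 1 := ⟨s - 1, by omega⟩
  rw [cLag_succ β c (by omega)]
  have := hβ (s + 1) (by omega)
  have := hc (s + 1) (by omega)
  have := cLag_nonneg hβ hc ht (show t ≤ s by omega)
  positivity

end Lag

/-! ### Moments of the measure-valued autoregressive gamma process -/

section PastSigma

variable {Ω E : Type*} [MeasurableSpace E] {W : ℕ → Ω → E}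

lemma pastSigma_le [mΩ : MeasurableSpace Ω] (hW : ∀ t, 1 ≤ t → Measurable (W t)) (t : ℕ) : pastSigma W t ≤ mΩ :=
  iSup₂_le fun s hs => (hW s hs.1).comap_le

lemma measurable_pastSigma {s t : ℕ} (hs : 1 ≤ s) (hst : s ≤ t) :
    Measurable[pastSigma W t] (W s) :=
  (comap_measurable (W s)).mono
    (le_iSup₂ (f := fun s (_ : s ∈ Set.Icc 1 t) => MeasurableSpace.comap (W s) inferInstance)
      s ⟨hs, hst⟩) le_rfl

lemma fullSigma_le [mΩ : MeasurableSpace Ω] (hW : ∀ t, 1 ≤ t → Measurable (W t)) : fullSigma W ≤ mΩ :=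
  iSup₂_le fun s hs => (hW s hs).comap_le

end PastSigma

lemma IsBoundedlyFinite.smul {X : Type*} [MetricSpace X] [MeasurableSpace X] {m : Measure X}
    (hm : IsBoundedlyFinite m) (b : ℝ) : IsBoundedlyFinite (ENNReal.ofReal b • m) := fun B hB => by
  rw [Measure.smul_apply, smul_eq_mul]
  exact ENNReal.mul_lt_top ENNReal.ofReal_lt_top (hm B hB)

namespace IsMARG

variable {Ω Θ : Type*} [MeasurableSpace Ω] [MetricSpace Θ] [MeasurableSpace Θ]
  {P : Measure Ω} {H : Measure Θ} {β c : ℕ → ℝ} {W : ℕ → Ω → Measure Θ}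

lemma measurable_lintegral (hW : IsMARG P H β c W) {t : ℕ} (ht : 1 ≤ t) {g : Θ → ℝ≥0∞}
    (hg : Measurable g) : Measurable fun ω => ∫⁻ θ, g θ ∂W t ω :=
  (Measure.measurable_lintegral hg).comp (hW.measurable t ht)

/-- The affine conditional mean of `W_{t+1}(g)`, tested against a variable `G` of the past: `G = 1`
gives the mean recursion, and an earlier mass `G = W_s(g₁)` the lag recursion. -/
lemma lintegral_mul_lintegral_succ [OpensMeasurableSpace Θ] (hW : IsMARG P H β c W) {t : ℕ} (ht : 1 ≤ t)
    {G : Ω → ℝ≥0∞} (hG : Measurable[pastSigma W t] G) {g : Θ → ℝ≥0∞} (hg : Measurable g) :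
    ∫⁻ ω, G ω * ∫⁻ θ, g θ ∂W (t + 1) ω ∂P =
      ENNReal.ofReal (c (t + 1)) * (∫⁻ θ, g θ ∂H) * ∫⁻ ω, G ω ∂P +
      ENNReal.ofReal (β (t + 1) * c (t + 1)) * ∫⁻ ω, G ω * ∫⁻ θ, g θ ∂W t ω ∂P := by
  obtain ⟨ν, hν, hν'⟩ := hW.transition t ht
  have hβ := hW.beta_pos (t + 1) (by omega)
  have hc := hW.c_pos (t + 1) (by omega)
  have hm := pastSigma_le hW.measurable t
  have hG' : Measurable G := hG.mono hm le_rfl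
  rw [hν.lintegral_mul_comp_eq hm (hW.measurable _ (by omega)) hG
    (Measure.measurable_lintegral hg)]
  have hGg : Measurable fun ω => G ω * ∫⁻ θ, g θ ∂W t ω :=
    hG'.mul (hW.measurable_lintegral ht hg)
  rw [← lintegral_const_mul _ hG', ← lintegral_const_mul _ hGg,
    ← lintegral_add_left (hG'.const_mul _)]
  refine lintegral_congr_ae ?_
  filter_upwards [hν', hW.boundedlyFinite t ht] with ω hω hbf
  rw [hω.lintegral_lintegral hW.base_boundedlyFinite (hbf.smul _) hc hg, lintegral_smul_measure,
    smul_eq_mul, ENNReal.ofReal_mul hβ.le]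
  ring

lemma lintegral_mul_succ_succ [OpensMeasurableSpace Θ] (hW : IsMARG P H β c W) {t : ℕ} (ht : 1 ≤ t)
    {g₁ g₂ : Θ → ℝ≥0∞} (hg₁ : Measurable g₁) (hg₂ : Measurable g₂) :
    ∫⁻ ω, (∫⁻ θ, g₁ θ ∂W (t + 1) ω) * ∫⁻ θ, g₂ θ ∂W (t + 1) ω ∂P =
      ∫⁻ ω, ((ENNReal.ofReal (c (t + 1)) * (∫⁻ θ, g₁ θ ∂H) +
          ENNReal.ofReal (β (t + 1) * c (t + 1)) * ∫⁻ θ, g₁ θ ∂W t ω) *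
        (ENNReal.ofReal (c (t + 1)) * (∫⁻ θ, g₂ θ ∂H) +
          ENNReal.ofReal (β (t + 1) * c (t + 1)) * ∫⁻ θ, g₂ θ ∂W t ω) +
        (ENNReal.ofReal (c (t + 1) ^ 2) * (∫⁻ θ, g₁ θ * g₂ θ ∂H) +
          ENNReal.ofReal (2 * c (t + 1) * (β (t + 1) * c (t + 1))) *
            ∫⁻ θ, g₁ θ * g₂ θ ∂W t ω)) ∂P := by
  obtain ⟨ν, hν, hν'⟩ := hW.transition t ht
  have hβ := hW.beta_pos (t + 1) (by omega)
  have hc := hW.c_pos (t + 1) (by omega)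
  have h := hν.lintegral_mul_comp_eq (pastSigma_le hW.measurable t) (hW.measurable _ (by omega))
    (G := fun _ => 1) measurable_const
    ((Measure.measurable_lintegral hg₁).mul (Measure.measurable_lintegral hg₂))
  simp only [one_mul, Pi.mul_apply] at h
  rw [h]
  refine lintegral_congr_ae ?_
  filter_upwards [hν', hW.boundedlyFinite t ht] with ω hω hbf
  rw [hω.lintegral_lintegral_mul hW.base_boundedlyFinite (hbf.smul _) hc hg₁ hg₂]
  simp only [lintegral_smul_measure, smul_eq_mul]
  rw [ENNReal.ofReal_mul (show 0 ≤ 2 * c (t + 1) by positivity), ENNReal.ofReal_mul zero_le_two,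
    ENNReal.ofReal_mul hβ.le, ENNReal.ofReal_pow hc.le, ENNReal.ofReal_ofNat]
  ring

/-- The mean of the process: `E W_t(g) = c_{t|1} H(g) + ρ_{t|1} E W_1(g)`. -/
theorem lintegral_lintegral_eq [OpensMeasurableSpace Θ] [IsProbabilityMeasure P] (hW : IsMARG P H β c W)
    {t : ℕ} (ht : 1 ≤ t) {g : Θ → ℝ≥0∞} (hg : Measurable g) :
    ∫⁻ ω, ∫⁻ θ, g θ ∂W t ω ∂P = ENNReal.ofReal (cLag β c t 1) * (∫⁻ θ, g θ ∂H) +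
      ENNReal.ofReal (rhoLag β c t 1) * ∫⁻ ω, ∫⁻ θ, g θ ∂W 1 ω ∂P := by
  induction t, ht using Nat.le_induction with
  | base => simp [cLag_self, rhoLag_self]
  | succ t ht ih =>
    have h := hW.lintegral_mul_lintegral_succ ht (G := fun _ => 1) measurable_const hg
    simp only [one_mul, lintegral_one, measure_univ, mul_one] at h
    have hβ := hW.beta_pos (t + 1) (by omega)
    have hc := hW.c_pos (t + 1) (by omega)
    have hcl := cLag_nonneg hW.beta_pos hW.c_pos le_rfl ht
    have hr : 0 ≤ β (t + 1) * c (t + 1) := by positivity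
    rw [h, ih, rhoLag_succ β c ht, cLag_succ β c ht,
      ENNReal.ofReal_add hc.le (mul_nonneg hr hcl), ENNReal.ofReal_mul hr, ENNReal.ofReal_mul hr]
    ring

end IsMARG

namespace IsMARG

variable {Ω Θ : Type*} [MeasurableSpace Ω] [MetricSpace Θ] [MeasurableSpace Θ]
  {P : Measure Ω} {H : Measure Θ} {β c : ℕ → ℝ} {W : ℕ → Ω → Measure Θ}

lemma lintegral_lintegral_ne_top [OpensMeasurableSpace Θ] [IsProbabilityMeasure P]
    (hW : IsMARG P H β c W) {t : ℕ} (ht : 1 ≤ t) {g : Θ → ℝ≥0∞} (hg : Measurable g)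
    (hH : ∫⁻ θ, g θ ∂H ≠ ∞) (h1 : ∫⁻ ω, ∫⁻ θ, g θ ∂W 1 ω ∂P ≠ ∞) :
    ∫⁻ ω, ∫⁻ θ, g θ ∂W t ω ∂P ≠ ∞ := by
  rw [hW.lintegral_lintegral_eq ht hg]
  finiteness

lemma toReal_lintegral_lintegral_eq [OpensMeasurableSpace Θ] [IsProbabilityMeasure P]
    (hW : IsMARG P H β c W) {t : ℕ} (ht : 1 ≤ t) {g : Θ → ℝ≥0∞} (hg : Measurable g)
    (hH : ∫⁻ θ, g θ ∂H ≠ ∞) (h1 : ∫⁻ ω, ∫⁻ θ, g θ ∂W 1 ω ∂P ≠ ∞) :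
    (∫⁻ ω, ∫⁻ θ, g θ ∂W t ω ∂P).toReal = cLag β c t 1 * (∫⁻ θ, g θ ∂H).toReal +
      rhoLag β c t 1 * (∫⁻ ω, ∫⁻ θ, g θ ∂W 1 ω ∂P).toReal := by
  rw [hW.lintegral_lintegral_eq ht hg, ENNReal.toReal_add (by finiteness) (by finiteness),
    ENNReal.toReal_mul, ENNReal.toReal_mul,
    ENNReal.toReal_ofReal (cLag_nonneg hW.beta_pos hW.c_pos le_rfl ht),
    ENNReal.toReal_ofReal (rhoLag_pos hW.beta_pos hW.c_pos le_rfl).le]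

lemma toReal_lintegral_lintegral_succ [OpensMeasurableSpace Θ] [IsProbabilityMeasure P]
    (hW : IsMARG P H β c W) {t : ℕ} (ht : 1 ≤ t) {g : Θ → ℝ≥0∞} (hg : Measurable g)
    (hH : ∫⁻ θ, g θ ∂H ≠ ∞) (h1 : ∫⁻ ω, ∫⁻ θ, g θ ∂W 1 ω ∂P ≠ ∞) :
    (∫⁻ ω, ∫⁻ θ, g θ ∂W (t + 1) ω ∂P).toReal = c (t + 1) * (∫⁻ θ, g θ ∂H).toReal +
      β (t + 1) * c (t + 1) * (∫⁻ ω, ∫⁻ θ, g θ ∂W t ω ∂P).toReal := by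
  rw [hW.toReal_lintegral_lintegral_eq (by omega) hg hH h1,
    hW.toReal_lintegral_lintegral_eq ht hg hH h1, cLag_succ β c ht, rhoLag_succ β c ht]
  ring

/-- The covariance of the masses that the process gives to `g₁` and `g₂` at one time. -/
theorem toReal_lintegral_mul_eq [OpensMeasurableSpace Θ] [IsProbabilityMeasure P]
    (hW : IsMARG P H β c W) {t : ℕ} (ht : 1 ≤ t) {g₁ g₂ : Θ → ℝ≥0∞}
    (hg₁ : Measurable g₁) (hg₂ : Measurable g₂)
    (hH₁ : ∫⁻ θ, g₁ θ ∂H ≠ ∞) (hH₂ : ∫⁻ θ, g₂ θ ∂H ≠ ∞) (hH₁₂ : ∫⁻ θ, g₁ θ * g₂ θ ∂H ≠ ∞)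
    (h₁ : ∫⁻ ω, ∫⁻ θ, g₁ θ ∂W 1 ω ∂P ≠ ∞) (h₂ : ∫⁻ ω, ∫⁻ θ, g₂ θ ∂W 1 ω ∂P ≠ ∞)
    (h₁₂ : ∫⁻ ω, ∫⁻ θ, g₁ θ * g₂ θ ∂W 1 ω ∂P ≠ ∞)
    (hQ : ∫⁻ ω, (∫⁻ θ, g₁ θ ∂W 1 ω) * ∫⁻ θ, g₂ θ ∂W 1 ω ∂P ≠ ∞) :
    ∫⁻ ω, (∫⁻ θ, g₁ θ ∂W t ω) * ∫⁻ θ, g₂ θ ∂W t ω ∂P ≠ ∞ ∧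
    (∫⁻ ω, (∫⁻ θ, g₁ θ ∂W t ω) * ∫⁻ θ, g₂ θ ∂W t ω ∂P).toReal =
      (∫⁻ ω, ∫⁻ θ, g₁ θ ∂W t ω ∂P).toReal * (∫⁻ ω, ∫⁻ θ, g₂ θ ∂W t ω ∂P).toReal +
      (cLag β c t 1 ^ 2 * (∫⁻ θ, g₁ θ * g₂ θ ∂H).toReal +
        2 * rhoLag β c t 1 * cLag β c t 1 * (∫⁻ ω, ∫⁻ θ, g₁ θ * g₂ θ ∂W 1 ω ∂P).toReal +
        rhoLag β c t 1 ^ 2 * ((∫⁻ ω, (∫⁻ θ, g₁ θ ∂W 1 ω) * ∫⁻ θ, g₂ θ ∂W 1 ω ∂P).toReal -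
          (∫⁻ ω, ∫⁻ θ, g₁ θ ∂W 1 ω ∂P).toReal * (∫⁻ ω, ∫⁻ θ, g₂ θ ∂W 1 ω ∂P).toReal)) := by
  induction t, ht using Nat.le_induction with
  | base =>
    refine ⟨hQ, ?_⟩
    rw [cLag_self, rhoLag_self]
    ring
  | succ t ht ih =>
    obtain ⟨ihf, ih⟩ := ih
    have hβ := hW.beta_pos (t + 1) (by omega)
    have hc := hW.c_pos (t + 1) (by omega)
    have m₁ := hW.measurable_lintegral ht hg₁
    have m₂ := hW.measurable_lintegral ht hg₂
    have m₁₂ := hW.measurable_lintegral ht (hg₁.mul hg₂)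
    simp only [Pi.mul_apply] at m₁₂
    have f₁ := hW.lintegral_lintegral_ne_top ht hg₁ hH₁ h₁
    have f₂ := hW.lintegral_lintegral_ne_top ht hg₂ hH₂ h₂
    have f₁₂ := hW.lintegral_lintegral_ne_top ht (hg₁.mul hg₂) hH₁₂ h₁₂
    simp only [Pi.mul_apply] at f₁₂
    have e₁₂ := hW.toReal_lintegral_lintegral_eq ht (hg₁.mul hg₂) hH₁₂ h₁₂
    simp only [Pi.mul_apply] at e₁₂
    have key : ∫⁻ ω, (∫⁻ θ, g₁ θ ∂W (t + 1) ω) * ∫⁻ θ, g₂ θ ∂W (t + 1) ω ∂P =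
        ENNReal.ofReal (c (t + 1)) * (∫⁻ θ, g₁ θ ∂H) *
            (ENNReal.ofReal (c (t + 1)) * ∫⁻ θ, g₂ θ ∂H) +
          ENNReal.ofReal (c (t + 1)) * (∫⁻ θ, g₁ θ ∂H) * ENNReal.ofReal (β (t + 1) * c (t + 1)) *
            ∫⁻ ω, ∫⁻ θ, g₂ θ ∂W t ω ∂P +
          ENNReal.ofReal (c (t + 1)) * (∫⁻ θ, g₂ θ ∂H) * ENNReal.ofReal (β (t + 1) * c (t + 1)) *
            ∫⁻ ω, ∫⁻ θ, g₁ θ ∂W t ω ∂P +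
          ENNReal.ofReal (β (t + 1) * c (t + 1)) ^ 2 *
            ∫⁻ ω, (∫⁻ θ, g₁ θ ∂W t ω) * ∫⁻ θ, g₂ θ ∂W t ω ∂P +
          ENNReal.ofReal (c (t + 1) ^ 2) * (∫⁻ θ, g₁ θ * g₂ θ ∂H) +
          ENNReal.ofReal (2 * c (t + 1) * (β (t + 1) * c (t + 1))) *
            ∫⁻ ω, ∫⁻ θ, g₁ θ * g₂ θ ∂W t ω ∂P := by
      rw [hW.lintegral_mul_succ_succ ht hg₁ hg₂, ← lintegral_const_mul _ m₁,
        ← lintegral_const_mul _ m₂, ← lintegral_const_mul _ m₁₂,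
        ← lintegral_const_mul _ (show Measurable fun ω => _ * _ from m₁.mul m₂)]
      -- Constants are rewritten as integrals over the probability space, so that all summands merge
      -- under one integral.
      have k : ∀ a : ℝ≥0∞, a = ∫⁻ _, a ∂P := fun a => by simp
      rw [k (ENNReal.ofReal (c (t + 1)) * (∫⁻ θ, g₁ θ ∂H) *
            (ENNReal.ofReal (c (t + 1)) * ∫⁻ θ, g₂ θ ∂H)),
        k (ENNReal.ofReal (c (t + 1) ^ 2) * (∫⁻ θ, g₁ θ * g₂ θ ∂H)),
        ← lintegral_add_right _ (by fun_prop), ← lintegral_add_right _ (by fun_prop),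
        ← lintegral_add_right _ (by fun_prop), ← lintegral_add_right _ (by fun_prop),
        ← lintegral_add_right _ (by fun_prop)]
      refine lintegral_congr fun ω => ?_
      simp only [lintegral_const, measure_univ, mul_one]
      ring
    rw [key]
    refine ⟨by finiteness, ?_⟩
    rw [ENNReal.toReal_add (by finiteness) (by finiteness),
      ENNReal.toReal_add (by finiteness) (by finiteness),
      ENNReal.toReal_add (by finiteness) (by finiteness),
      ENNReal.toReal_add (by finiteness) (by finiteness),
      ENNReal.toReal_add (by finiteness) (by finiteness)]
    simp only [ENNReal.toReal_mul, ENNReal.toReal_pow]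
    -- With `r = β_{t+1} c_{t+1}` and `C = c_{t|1}`, the coefficient of `H(g₁g₂)` is `c² + 2 c r C +
    -- r² C² = (c + r C)²`, and that of `E W_1(g₁g₂)` is `2 r ρ_{t|1} (c + r C)`.
    rw [ih, hW.toReal_lintegral_lintegral_succ ht hg₁ hH₁ h₁,
      hW.toReal_lintegral_lintegral_succ ht hg₂ hH₂ h₂, e₁₂, cLag_succ β c ht, rhoLag_succ β c ht,
      ENNReal.toReal_ofReal hc.le, ENNReal.toReal_ofReal (by positivity),
      ENNReal.toReal_ofReal (by positivity), ENNReal.toReal_ofReal (by positivity)]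
    ring

/-- The covariance of the masses given to `g₁` and `g₂` decays with the lag through `ρ`. -/
theorem toReal_lintegral_mul_lag_eq [OpensMeasurableSpace Θ] [IsProbabilityMeasure P]
    (hW : IsMARG P H β c W) {t : ℕ} (ht : 1 ≤ t) {g₁ g₂ : Θ → ℝ≥0∞}
    (hg₁ : Measurable g₁) (hg₂ : Measurable g₂)
    (hH₁ : ∫⁻ θ, g₁ θ ∂H ≠ ∞) (hH₂ : ∫⁻ θ, g₂ θ ∂H ≠ ∞)
    (h₁ : ∫⁻ ω, ∫⁻ θ, g₁ θ ∂W 1 ω ∂P ≠ ∞) (h₂ : ∫⁻ ω, ∫⁻ θ, g₂ θ ∂W 1 ω ∂P ≠ ∞)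
    (hQ : ∫⁻ ω, (∫⁻ θ, g₁ θ ∂W t ω) * ∫⁻ θ, g₂ θ ∂W t ω ∂P ≠ ∞) (h : ℕ) :
    ∫⁻ ω, (∫⁻ θ, g₁ θ ∂W t ω) * ∫⁻ θ, g₂ θ ∂W (t + h) ω ∂P ≠ ∞ ∧
    (∫⁻ ω, (∫⁻ θ, g₁ θ ∂W t ω) * ∫⁻ θ, g₂ θ ∂W (t + h) ω ∂P).toReal =
      (∫⁻ ω, ∫⁻ θ, g₁ θ ∂W t ω ∂P).toReal * (∫⁻ ω, ∫⁻ θ, g₂ θ ∂W (t + h) ω ∂P).toReal +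
      rhoLag β c (t + h) t * ((∫⁻ ω, (∫⁻ θ, g₁ θ ∂W t ω) * ∫⁻ θ, g₂ θ ∂W t ω ∂P).toReal -
        (∫⁻ ω, ∫⁻ θ, g₁ θ ∂W t ω ∂P).toReal * (∫⁻ ω, ∫⁻ θ, g₂ θ ∂W t ω ∂P).toReal) := by
  induction h with
  | zero =>
    refine ⟨hQ, ?_⟩
    rw [add_zero, rhoLag_self]
    ring
  | succ h ih =>
    obtain ⟨ihf, ih⟩ := ih
    have hβ := hW.beta_pos (t + h + 1) (by omega)
    have hc := hW.c_pos (t + h + 1) (by omega)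
    have f₁ := hW.lintegral_lintegral_ne_top ht hg₁ hH₁ h₁
    have hG : Measurable[pastSigma W (t + h)] fun ω => ∫⁻ θ, g₁ θ ∂W t ω :=
      (Measure.measurable_lintegral hg₁).comp (measurable_pastSigma ht (by omega))
    rw [← add_assoc, hW.lintegral_mul_lintegral_succ (show 1 ≤ t + h by omega) hG hg₂]
    refine ⟨by finiteness, ?_⟩
    rw [ENNReal.toReal_add (by finiteness) (by finiteness)]
    simp only [ENNReal.toReal_mul]
    rw [ih, hW.toReal_lintegral_lintegral_succ (show 1 ≤ t + h by omega) hg₂ hH₂ h₂,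
      rhoLag_succ β c (show t ≤ t + h by omega), ENNReal.toReal_ofReal hc.le,
      ENNReal.toReal_ofReal (by positivity)]
    ring

end IsMARG

/-! ### Poisson random measures -/

lemma lintegral_poissonMeasure (r : ℝ≥0) (f : ℕ → ℝ≥0∞) :
    ∫⁻ k, f k ∂poissonMeasure r =
      ∑' n : ℕ, ENNReal.ofReal (Real.exp (-r) * r ^ n / n.factorial) * f n := by
  simp only [poissonMeasure, lintegral_sum_measure, lintegral_smul_measure, lintegral_dirac,
    smul_eq_mul]

/-- The Stein–Chen identity. -/
lemma lintegral_natCast_mul_poissonMeasure (r : ℝ≥0) (f : ℕ → ℝ≥0∞) :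
    ∫⁻ k, (k : ℝ≥0∞) * f k ∂poissonMeasure r = r * ∫⁻ k, f (k + 1) ∂poissonMeasure r := by
  rw [lintegral_poissonMeasure, lintegral_poissonMeasure, tsum_eq_zero_add' ENNReal.summable,
    ← ENNReal.tsum_mul_left]
  simp only [Nat.cast_zero, zero_mul, mul_zero, zero_add]
  refine tsum_congr fun n => ?_
  have h : ENNReal.ofReal (Real.exp (-r) * r ^ (n + 1) / (n + 1).factorial) * ((n + 1 : ℕ) : ℝ≥0∞) =
      r * ENNReal.ofReal (Real.exp (-r) * r ^ n / n.factorial) := by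
    rw [← ENNReal.ofReal_natCast, ← ENNReal.ofReal_mul (by positivity), ← ENNReal.ofReal_coe_nnreal,
      ← ENNReal.ofReal_mul (by positivity)]
    congr 1
    rw [Nat.factorial_succ]
    push_cast
    field_simp
    ring
  rw [← mul_assoc, h, mul_assoc]

lemma lintegral_natCast_poissonMeasure (r : ℝ≥0) :
    ∫⁻ k, (k : ℝ≥0∞) ∂poissonMeasure r = r := by
  simpa using lintegral_natCast_mul_poissonMeasure r fun _ => 1

lemma lintegral_natCast_mul_self_poissonMeasure (r : ℝ≥0) :
    ∫⁻ k, (k : ℝ≥0∞) * k ∂poissonMeasure r = r * r + r := by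
  rw [lintegral_natCast_mul_poissonMeasure]
  push_cast
  rw [lintegral_add_right _ measurable_const, lintegral_natCast_poissonMeasure]
  simp [mul_add]

namespace IsPoissonLaw

variable {Y : Type*} [MeasurableSpace Y] {Q : Measure (Measure Y)} {L : Measure Y}

lemma lintegral_comp_apply (hQ : IsPoissonLaw Q L) {B : Set Y} (hB : MeasurableSet B)
    (hL : L B ≠ ∞) {f : ℝ≥0∞ → ℝ≥0∞} (hf : Measurable f) :
    ∫⁻ n, f (n B) ∂Q = ∫⁻ k, f (k : ℕ) ∂poissonMeasure (L B).toNNReal := by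
  rw [← lintegral_map hf (Measure.measurable_coe hB), hQ.count_of_finite B hB hL,
    lintegral_map hf (measurable_of_countable _)]

lemma lintegral_apply (hQ : IsPoissonLaw Q L) {B : Set Y} (hB : MeasurableSet B) :
    ∫⁻ n, n B ∂Q = L B := by
  have := hQ.isProbabilityMeasure
  by_cases hL : L B = ∞
  · rw [lintegral_congr_ae (hQ.count_of_infinite B hB hL), hL]
    simp
  · rw [hQ.lintegral_comp_apply hB hL (f := fun x => x) measurable_id, lintegral_natCast_poissonMeasure, ENNReal.coe_toNNReal hL]

lemma lintegral_apply_mul_self (hQ : IsPoissonLaw Q L) {B : Set Y} (hB : MeasurableSet B)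
    (hL : L B ≠ ∞) : ∫⁻ n, n B * n B ∂Q = L B * L B + L B := by
  rw [hQ.lintegral_comp_apply hB hL (f := fun x => x * x) (measurable_id.mul measurable_id),
    lintegral_natCast_mul_self_poissonMeasure, ENNReal.coe_toNNReal hL]

lemma lintegral_apply_mul_of_disjoint (hQ : IsPoissonLaw Q L) {B C : Set Y}
    (hB : MeasurableSet B) (hC : MeasurableSet C) (hBC : Disjoint B C) :
    ∫⁻ n, n B * n C ∂Q = L B * L C := by
  have hp : Pairwise (Function.onFun Disjoint ![B, C]) := by
    intro i j hij
    fin_cases i <;> fin_cases j <;> first | exact absurd rfl hij | exact hBC | exact hBC.symm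
  have h := (hQ.indep 2 ![B, C] (fun i => by fin_cases i <;> assumption) hp).indepFun
    (show (0 : Fin 2) ≠ 1 by decide)
  have h' := lintegral_mul_eq_lintegral_mul_lintegral_of_indepFun
    (Measure.measurable_coe hB) (Measure.measurable_coe hC) h
  rw [hQ.lintegral_apply hB, hQ.lintegral_apply hC] at h'
  exact h'

/-- The mixed second moment of a Poisson random measure. -/
theorem lintegral_apply_mul_apply (hQ : IsPoissonLaw Q L) {B C : Set Y} (hB : MeasurableSet B)
    (hC : MeasurableSet C) (hL : L B ≠ ∞) :
    ∫⁻ n, n B * n C ∂Q = L B * L C + L (B ∩ C) := by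
  have hBC := hB.inter hC
  have hCB := hC.inter hB
  have m : ∀ {A : Set Y}, MeasurableSet A → Measurable fun n : Measure Y => n A :=
    Measure.measurable_coe
  -- Split along the disjoint pieces `B ∩ C`, `B \ C`, `C \ B`. Only the square of `n (B ∩ C)` is
  -- not a product of independent counts, and it contributes the extra `L (B ∩ C)`.
  have e : ∀ n : Measure Y, n B * n C = n (B ∩ C) * n (B ∩ C) + n (B ∩ C) * n (C \ B) +
      n (B \ C) * n (B ∩ C) + n (B \ C) * n (C \ B) := fun n => by
    rw [← measure_inter_add_sdiff B hC, ← measure_inter_add_sdiff C hB, Set.inter_comm C B]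
    ring
  have hLi : L (B ∩ C) ≠ ∞ := measure_ne_top_of_subset Set.inter_subset_left hL
  have d : ∀ {A D : Set Y}, MeasurableSet A → MeasurableSet D →
      Measurable fun n : Measure Y => n A * n D := fun hA hD => (m hA).mul (m hD)
  rw [lintegral_congr e, lintegral_add_right _ (d (hB.diff hC) (hC.diff hB)),
    lintegral_add_right _ (d (hB.diff hC) hBC), lintegral_add_right _ (d hBC (hC.diff hB)),
    hQ.lintegral_apply_mul_self hBC hLi,
    hQ.lintegral_apply_mul_of_disjoint hBC (hC.diff hB)
      (Set.disjoint_sdiff_right.mono_left Set.inter_subset_left),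
    hQ.lintegral_apply_mul_of_disjoint (hB.diff hC) hBC
      (Set.disjoint_sdiff_left.mono_right Set.inter_subset_right),
    hQ.lintegral_apply_mul_of_disjoint (hB.diff hC) (hC.diff hB)
      (Set.disjoint_sdiff_left.mono_right Set.sdiff_subset), e L]
  ring

end IsPoissonLaw

lemma IsBoundedlyFinite.sigmaFinite {X : Type*} [MetricSpace X] [MeasurableSpace X]
    {m : Measure X} (hm : IsBoundedlyFinite m) : SigmaFinite m := by
  rcases isEmpty_or_nonempty X with h | ⟨⟨x₀⟩⟩
  · rw [Measure.eq_zero_of_isEmpty m]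
    infer_instance
  · exact ⟨⟨⟨fun n => Metric.ball x₀ n, fun _ => trivial, fun n => hm _ Metric.isBounded_ball,
      Metric.iUnion_ball_nat x₀⟩⟩⟩

/-! ### The shot noise intensity -/

section ShotNoise

variable {Θ Y : Type*} [MeasurableSpace Θ] [MeasurableSpace Y] {ℓ : Measure Y} [SigmaFinite ℓ]
  {K : Y → Θ → ℝ≥0}

lemma measurable_kernelMass (hK : Measurable (Function.uncurry K)) (B : Set Y) :
    Measurable (kernelMass ℓ K B) := by
  have h : Measurable fun p : Θ × Y => (K p.2 p.1 : ℝ≥0∞) :=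
    (hK.comp measurable_swap).coe_nnreal_ennreal
  exact h.lintegral_prod_right' (ν := ℓ.restrict B)

lemma lintegral_kernelMass (hK : Measurable (Function.uncurry K)) (B : Set Y) (w : Measure Θ)
    [SFinite w] : ∫⁻ θ, kernelMass ℓ K B θ ∂w = ∫⁻ y in B, ∫⁻ θ, (K y θ : ℝ≥0∞) ∂w ∂ℓ := by
  have h : Measurable fun p : Θ × Y => (K p.2 p.1 : ℝ≥0∞) :=
    (hK.comp measurable_swap).coe_nnreal_ennreal
  exact lintegral_lintegral_swap (μ := w) (ν := ℓ.restrict B) h.aemeasurable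

lemma measurable_lintegral_kernel (hK : Measurable (Function.uncurry K)) (w : Measure Θ)
    [SFinite w] : Measurable fun y => ∫⁻ θ, (K y θ : ℝ≥0∞) ∂w :=
  hK.coe_nnreal_ennreal.lintegral_prod_right' (ν := w)

lemma shotNoiseIntensity_apply (hK : Measurable (Function.uncurry K)) (κ : ℝ≥0) {B : Set Y}
    (hB : MeasurableSet B) (w : Measure Θ) [SFinite w] :
    shotNoiseIntensity ℓ K κ w B = κ * ∫⁻ θ, kernelMass ℓ K B θ ∂w := by
  rw [shotNoiseIntensity, withDensity_apply _ hB,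
    lintegral_const_mul _ (measurable_lintegral_kernel hK w), lintegral_kernelMass hK]

end ShotNoise

/-- The law of `(X, Z)` is the mixture of the products `ν ω ⊗ η ω`, since the two finite measures
agree on rectangles. Each product then factorizes the integral. -/
lemma lintegral_mul_comp_of_condIndep {Ω E : Type*} [MeasurableSpace Ω] [MeasurableSpace E]
    {P : Measure Ω} [IsFiniteMeasure P] {X Z : Ω → E} {ν η : Ω → Measure E} (hX : Measurable X)
    (hZ : Measurable Z) (hν : Measurable ν) (hη : Measurable η)
    (pν : ∀ ω, IsProbabilityMeasure (ν ω)) (pη : ∀ ω, IsProbabilityMeasure (η ω))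
    (h : ∀ A B : Set E, MeasurableSet A → MeasurableSet B →
      P (X ⁻¹' A ∩ Z ⁻¹' B) = ∫⁻ ω, ν ω A * η ω B ∂P)
    {Φ Ψ : E → ℝ≥0∞} (hΦ : Measurable Φ) (hΨ : Measurable Ψ) :
    ∫⁻ ω, Φ (X ω) * Ψ (Z ω) ∂P = ∫⁻ ω, (∫⁻ x, Φ x ∂ν ω) * ∫⁻ x, Ψ x ∂η ω ∂P := by
  let k₁ : Kernel Ω E := ⟨ν, hν⟩
  let k₂ : Kernel Ω E := ⟨η, hη⟩
  have : IsMarkovKernel k₁ := ⟨pν⟩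
  have : IsMarkovKernel k₂ := ⟨pη⟩
  have hXZ : Measurable fun ω => (X ω, Z ω) := hX.prodMk hZ
  have e : P.map (fun ω => (X ω, Z ω)) = P.bind (k₁ ×ₖ k₂) := by
    have : IsFiniteMeasure (P.map fun ω => (X ω, Z ω)) := Measure.isFiniteMeasure_map _ _
    refine Measure.ext_prod fun {A B} hA hB => ?_
    rw [Measure.map_apply hXZ (hA.prod hB), Measure.bind_apply (hA.prod hB)
      (Kernel.aemeasurable _)]
    simp only [Kernel.prod_apply, Measure.prod_prod]
    exact h A B hA hB
  have hΦΨ : Measurable fun p : E × E => Φ p.1 * Ψ p.2 :=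
    (hΦ.comp measurable_fst).mul (hΨ.comp measurable_snd)
  calc ∫⁻ ω, Φ (X ω) * Ψ (Z ω) ∂P = ∫⁻ p, Φ p.1 * Ψ p.2 ∂P.map (fun ω => (X ω, Z ω)) :=
        (lintegral_map hΦΨ hXZ).symm
    _ = ∫⁻ ω, (∫⁻ x, Φ x ∂ν ω) * ∫⁻ x, Ψ x ∂η ω ∂P := by
        rw [e, Measure.lintegral_bind (Kernel.aemeasurable _) hΦΨ.aemeasurable]
        refine lintegral_congr fun ω => ?_
        rw [Kernel.prod_apply, lintegral_prod_mul hΦ.aemeasurable hΨ.aemeasurable]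
        rfl

/-! ### Moments of the counts in terms of the driving process -/

namespace IsSNMARG

variable {Ω Θ Y : Type*} [MeasurableSpace Ω] [MetricSpace Θ] [MeasurableSpace Θ]
  [MeasurableSpace Y] {P : Measure Ω} {H : Measure Θ} {β c : ℕ → ℝ} {W : ℕ → Ω → Measure Θ}
  {ℓ : Measure Y} {K : Y → Θ → ℝ≥0} {κ : ℕ → ℝ≥0} {N : ℕ → Ω → Measure Y}

lemma measurable_apply (hN : IsSNMARG P H β c W ℓ K κ N) {t : ℕ} (ht : 1 ≤ t) {B : Set Y}
    (hB : MeasurableSet B) : Measurable fun ω => N t ω B :=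
  (Measure.measurable_coe hB).comp (hN.measurable t ht)

lemma lintegral_apply [SigmaFinite ℓ] (hN : IsSNMARG P H β c W ℓ K κ N)
    (hK : Measurable (Function.uncurry K)) {t : ℕ} (ht : 1 ≤ t) {B : Set Y}
    (hB : MeasurableSet B) :
    ∫⁻ ω, N t ω B ∂P = κ t * ∫⁻ ω, ∫⁻ θ, kernelMass ℓ K B θ ∂W t ω ∂P := by
  obtain ⟨ν, hν, -⟩ := hN.cond_poisson
  have h := (hν t ht).1.lintegral_mul_comp_eq (fullSigma_le hN.isMARG.measurable)
    (hN.measurable t ht) (G := fun _ => 1) measurable_const (Measure.measurable_coe hB)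
  simp only [one_mul] at h
  rw [h, ← lintegral_const_mul _ (hN.isMARG.measurable_lintegral ht (measurable_kernelMass hK B))]
  refine lintegral_congr_ae ?_
  filter_upwards [(hν t ht).2, hN.isMARG.boundedlyFinite t ht] with ω hω hbf
  have := hbf.sigmaFinite
  rw [hω.lintegral_apply hB, shotNoiseIntensity_apply hK _ hB]

lemma lintegral_apply_mul_apply_of_ne [SigmaFinite ℓ] [IsFiniteMeasure P]
    (hN : IsSNMARG P H β c W ℓ K κ N)
    (hK : Measurable (Function.uncurry K)) {s t : ℕ} (hs : 1 ≤ s) (ht : 1 ≤ t) (hst : s ≠ t)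
    {B C : Set Y} (hB : MeasurableSet B) (hC : MeasurableSet C) :
    ∫⁻ ω, N s ω B * N t ω C ∂P = κ s * κ t *
      ∫⁻ ω, (∫⁻ θ, kernelMass ℓ K B θ ∂W s ω) * ∫⁻ θ, kernelMass ℓ K C θ ∂W t ω ∂P := by
  obtain ⟨ν, hν, hind⟩ := hN.cond_poisson
  have hm := fullSigma_le hN.isMARG.measurable
  have h := lintegral_mul_comp_of_condIndep (hN.measurable s hs) (hN.measurable t ht)
    ((hν s hs).1.measurable.mono hm le_rfl) ((hν t ht).1.measurable.mono hm le_rfl)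
    (hν s hs).1.isProbabilityMeasure (hν t ht).1.isProbabilityMeasure (fun A D hA hD => by
      have := hind {s, t} (by simp [hs, ht]) Set.univ MeasurableSet.univ
        (fun i => if i = s then A else D) (fun i => by split_ifs <;> assumption)
      simpa [Finset.prod_pair hst, hst.symm] using this)
    (Measure.measurable_coe hB) (Measure.measurable_coe hC)
  have hmeas : Measurable fun ω =>
      (∫⁻ θ, kernelMass ℓ K B θ ∂W s ω) * ∫⁻ θ, kernelMass ℓ K C θ ∂W t ω :=
    (hN.isMARG.measurable_lintegral hs (measurable_kernelMass hK B)).mul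
      (hN.isMARG.measurable_lintegral ht (measurable_kernelMass hK C))
  rw [h, ← lintegral_const_mul _ hmeas]
  refine lintegral_congr_ae ?_
  filter_upwards [(hν s hs).2, (hν t ht).2, hN.isMARG.boundedlyFinite s hs,
    hN.isMARG.boundedlyFinite t ht] with ω hωs hωt hbs hbt
  have := hbs.sigmaFinite
  have := hbt.sigmaFinite
  rw [hωs.lintegral_apply hB, hωt.lintegral_apply hC, shotNoiseIntensity_apply hK _ hB,
    shotNoiseIntensity_apply hK _ hC]
  ring

lemma lintegral_apply_mul_apply_self [SigmaFinite ℓ]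
    (hN : IsSNMARG P H β c W ℓ K κ N)
    (hK : Measurable (Function.uncurry K)) {t : ℕ} (ht : 1 ≤ t)
    {B C : Set Y} (hB : MeasurableSet B) (hC : MeasurableSet C)
    (hfin : ∫⁻ ω, ∫⁻ θ, kernelMass ℓ K B θ ∂W t ω ∂P ≠ ∞) :
    ∫⁻ ω, N t ω B * N t ω C ∂P = κ t * κ t *
      ∫⁻ ω, (∫⁻ θ, kernelMass ℓ K B θ ∂W t ω) * ∫⁻ θ, kernelMass ℓ K C θ ∂W t ω ∂P +
      κ t * ∫⁻ ω, ∫⁻ θ, kernelMass ℓ K (B ∩ C) θ ∂W t ω ∂P := by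
  obtain ⟨ν, hν, -⟩ := hN.cond_poisson
  have h := (hν t ht).1.lintegral_mul_comp_eq (fullSigma_le hN.isMARG.measurable)
    (hN.measurable t ht) (G := fun _ => 1) measurable_const
    ((Measure.measurable_coe hB).mul (Measure.measurable_coe hC))
  simp only [one_mul, Pi.mul_apply] at h
  have mB := hN.isMARG.measurable_lintegral ht (measurable_kernelMass (ℓ := ℓ) hK B)
  have mC := hN.isMARG.measurable_lintegral ht (measurable_kernelMass (ℓ := ℓ) hK C)
  have mI := hN.isMARG.measurable_lintegral ht (measurable_kernelMass (ℓ := ℓ) hK (B ∩ C))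
  have hmeas : Measurable fun ω =>
      (∫⁻ θ, kernelMass ℓ K B θ ∂W t ω) * ∫⁻ θ, kernelMass ℓ K C θ ∂W t ω := mB.mul mC
  rw [h, ← lintegral_const_mul _ hmeas, ← lintegral_const_mul _ mI,
    ← lintegral_add_right _ (mI.const_mul _)]
  refine lintegral_congr_ae ?_
  filter_upwards [(hν t ht).2, hN.isMARG.boundedlyFinite t ht, ae_lt_top mB hfin] with ω hω hbf hlt
  have := hbf.sigmaFinite
  -- A finite mean makes the conditional Poisson parameter of `B` almost surely finite, as the
  -- mixed-moment formula requires.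
  have hL : shotNoiseIntensity ℓ K (κ t) (W t ω) B ≠ ∞ := by
    rw [shotNoiseIntensity_apply hK _ hB]
    exact ENNReal.mul_ne_top ENNReal.coe_ne_top hlt.ne
  rw [hω.lintegral_apply_mul_apply hB hC hL, shotNoiseIntensity_apply hK _ hB,
    shotNoiseIntensity_apply hK _ hC, shotNoiseIntensity_apply hK _ (hB.inter hC)]
  ring

end IsSNMARG

/-! ### The covariance formula -/

section Covariance

variable {Ω : Type*} [MeasurableSpace Ω] {P : Measure Ω} {U V : Ω → ℝ≥0∞}

lemma integrable_toReal_mul_toReal (hU : Measurable U) (hV : Measurable V)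
    (hUV : ∫⁻ ω, U ω * V ω ∂P ≠ ∞) : Integrable (fun ω => (U ω).toReal * (V ω).toReal) P := by
  simp only [← ENNReal.toReal_mul]
  exact integrable_toReal_of_lintegral_ne_top (hU.mul hV).aemeasurable hUV

/-- Only the mixed moment is assumed finite, not the second moments, so the centred product is
expanded by hand. Equality almost everywhere suffices for `X` and `Z`, which accommodates Bochner
integrals against `W 1`. -/
lemma covariance_eq_toReal_sub [IsProbabilityMeasure P] (hU : Measurable U) (hV : Measurable V)
    (fU : ∫⁻ ω, U ω ∂P ≠ ∞) (fV : ∫⁻ ω, V ω ∂P ≠ ∞) (hUV : ∫⁻ ω, U ω * V ω ∂P ≠ ∞) {X Z : Ω → ℝ}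
    (hX : X =ᵐ[P] fun ω => (U ω).toReal) (hZ : Z =ᵐ[P] fun ω => (V ω).toReal) :
    cov[X, Z; P] = (∫⁻ ω, U ω * V ω ∂P).toReal -
      (∫⁻ ω, U ω ∂P).toReal * (∫⁻ ω, V ω ∂P).toReal := by
  have iU := integrable_toReal_of_lintegral_ne_top hU.aemeasurable fU
  have iV := integrable_toReal_of_lintegral_ne_top hV.aemeasurable fV
  have iUV := integrable_toReal_mul_toReal hU hV hUV
  have eU : ∫ ω, X ω ∂P = (∫⁻ ω, U ω ∂P).toReal := by
    rw [integral_congr_ae hX, integral_toReal hU.aemeasurable (ae_lt_top hU fU)]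
  have eV : ∫ ω, Z ω ∂P = (∫⁻ ω, V ω ∂P).toReal := by
    rw [integral_congr_ae hZ, integral_toReal hV.aemeasurable (ae_lt_top hV fV)]
  have eUV : ∫ ω, (U ω).toReal * (V ω).toReal ∂P = (∫⁻ ω, U ω * V ω ∂P).toReal := by
    simp only [← ENNReal.toReal_mul]
    exact integral_toReal (hU.mul hV).aemeasurable (ae_lt_top (hU.mul hV) hUV)
  have eU' := integral_toReal hU.aemeasurable (ae_lt_top hU fU)
  have eV' := integral_toReal hV.aemeasurable (ae_lt_top hV fV)
  rw [covariance, eU, eV]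
  set a := (∫⁻ ω, U ω ∂P).toReal
  set b := (∫⁻ ω, V ω ∂P).toReal
  have e : ∫ ω, (X ω - a) * (Z ω - b) ∂P =
      ∫ ω, ((U ω).toReal * (V ω).toReal - b * (U ω).toReal - a * (V ω).toReal + a * b) ∂P := by
    refine integral_congr_ae ?_
    filter_upwards [hX, hZ] with ω h1 h2
    rw [h1, h2]
    ring
  have i1 : Integrable (fun ω => (U ω).toReal * (V ω).toReal - b * (U ω).toReal) P :=
    iUV.sub (iU.const_mul b)
  have i2 : Integrable (fun ω => (U ω).toReal * (V ω).toReal - b * (U ω).toReal -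
      a * (V ω).toReal) P := i1.sub (iV.const_mul a)
  rw [e, integral_add i2 (integrable_const _), integral_sub i1 (iV.const_mul a),
    integral_sub iUV (iU.const_mul b), integral_const_mul, integral_const_mul, eU', eV', eUV]
  simp only [integral_const, probReal_univ, smul_eq_mul, one_mul]
  ring

end Covariance

lemma lintegral_meanMeasure {Ω Θ : Type*} [MeasurableSpace Ω] [MeasurableSpace Θ]
    {P : Measure Ω} {V : Ω → Measure Θ} (hV : Measurable V) {g : Θ → ℝ≥0∞} (hg : Measurable g) :
    ∫⁻ θ, g θ ∂(meanMeasure P V) = ∫⁻ ω, ∫⁻ θ, g θ ∂V ω ∂P :=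
  Measure.lintegral_bind hV.aemeasurable hg.aemeasurable

/-! ### Bounded sets satisfy the moment conditions -/

section WellDefined

variable {Θ Y : Type*} [MeasurableSpace Θ] [MeasurableSpace Y] {ℓ : Measure Y} [SigmaFinite ℓ]
  {K : Y → Θ → ℝ≥0}

lemma lintegral_kernelMass_mul_kernelMass (hK : Measurable (Function.uncurry K)) (B₁ B₂ : Set Y)
    (w : Measure Θ) [SFinite w] :
    ∫⁻ θ, kernelMass ℓ K B₁ θ * kernelMass ℓ K B₂ θ ∂w =
      ∫⁻ y in B₁ ×ˢ B₂, ∫⁻ θ, (K y.1 θ : ℝ≥0∞) * K y.2 θ ∂w ∂(ℓ.prod ℓ) := by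
  have hsec : ∀ θ, Measurable fun y => (K y θ : ℝ≥0∞) := fun θ =>
    (hK.comp (measurable_id.prodMk measurable_const)).coe_nnreal_ennreal
  have h : Measurable fun p : Θ × Y × Y => (K p.2.1 p.1 : ℝ≥0∞) * K p.2.2 p.1 :=
    (hK.comp ((measurable_fst.comp measurable_snd).prodMk measurable_fst)).coe_nnreal_ennreal.mul
      (hK.comp ((measurable_snd.comp measurable_snd).prodMk measurable_fst)).coe_nnreal_ennreal
  rw [← Measure.prod_restrict, ← lintegral_lintegral_swap h.aemeasurable]
  refine lintegral_congr fun θ => ?_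
  rw [lintegral_prod_mul (hsec θ).aemeasurable (hsec θ).aemeasurable]
  rfl

lemma lintegral_kernelMass_mul_lintegral_kernelMass (hK : Measurable (Function.uncurry K))
    (B₁ B₂ : Set Y) (w : Measure Θ) [SFinite w] :
    (∫⁻ θ, kernelMass ℓ K B₁ θ ∂w) * ∫⁻ θ, kernelMass ℓ K B₂ θ ∂w =
      ∫⁻ y in B₁ ×ˢ B₂, (∫⁻ θ, (K y.1 θ : ℝ≥0∞) ∂w) * (∫⁻ θ, (K y.2 θ : ℝ≥0∞) ∂w)
        ∂(ℓ.prod ℓ) := by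
  have h := measurable_lintegral_kernel hK w
  rw [← Measure.prod_restrict, lintegral_prod_mul h.aemeasurable h.aemeasurable,
    lintegral_kernelMass hK, lintegral_kernelMass hK]

/-- By Tonelli each required moment is one of the integrals in the integrability conditions; bounded
finiteness enters through σ-finiteness. -/
lemma IntegrabilityConditions.momentsWellDefined {Ω Θ Y : Type*} [MeasurableSpace Ω]
    [MetricSpace Θ] [MeasurableSpace Θ] [MetricSpace Y] [MeasurableSpace Y] {P : Measure Ω}
    {H : Measure Θ} {V : Ω → Measure Θ} {ℓ : Measure Y} [SigmaFinite ℓ] {K : Y → Θ → ℝ≥0}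
    (hInt : IntegrabilityConditions P H V ℓ K) (hK : Measurable (Function.uncurry K))
    (hH : IsBoundedlyFinite H) (hV : IsBoundedlyFinite (meanMeasure P V))
    (hV' : ∀ᵐ ω ∂P, IsBoundedlyFinite (V ω)) {B₁ B₂ : Set Y}
    (hB₁ : MeasurableSet B₁) (hB₂ : MeasurableSet B₂) (b₁ : Bornology.IsBounded B₁)
    (b₂ : Bornology.IsBounded B₂) : MomentsWellDefined P H V ℓ K B₁ B₂ := by
  have := hH.sigmaFinite
  have := hV.sigmaFinite
  refine ⟨?_, ?_, ?_, ?_⟩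
  · rw [lintegral_kernelMass hK]
    exact hInt.h1_mean B₁ b₁ hB₁
  · rw [lintegral_kernelMass hK]
    exact hInt.h1_mean B₂ b₂ hB₂
  · rw [lintegral_kernelMass_mul_kernelMass hK]
    exact hInt.h2 B₁ B₂ b₁ hB₁ b₂ hB₂
  · refine lt_of_eq_of_lt (lintegral_congr_ae ?_) (hInt.h3 B₁ B₂ b₁ hB₁ b₂ hB₂)
    filter_upwards [hV'] with ω hω
    have := hω.sigmaFinite
    exact lintegral_kernelMass_mul_lintegral_kernelMass hK B₁ B₂ (V ω)

end WellDefined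

namespace IsSNMARG

variable {Ω Θ Y : Type*} [MeasurableSpace Ω] [MetricSpace Θ] [MeasurableSpace Θ]
  [OpensMeasurableSpace Θ] [MeasurableSpace Y] {P : Measure Ω} [IsProbabilityMeasure P]
  {H : Measure Θ} {β c : ℕ → ℝ} {W : ℕ → Ω → Measure Θ}
  {ℓ : Measure Y} [SigmaFinite ℓ] {K : Y → Θ → ℝ≥0} {κ : ℕ → ℝ≥0} {N : ℕ → Ω → Measure Y}
  {B₁ B₂ : Set Y}

/-- Finiteness of the mixed moment of the counts, and the covariance formula in terms of
moments of `H` and of the initial random measure. -/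
theorem lintegral_counts_ne_top_and_covariance_eq (hN : IsSNMARG P H β c W ℓ K κ N)
    (hK : Measurable (Function.uncurry K)) (hB₁ : MeasurableSet B₁) (hB₂ : MeasurableSet B₂)
    (hM : MomentsWellDefined P H (W 1) ℓ K B₁ B₂) {t : ℕ} (ht : 1 ≤ t) (h : ℕ) :
    ∫⁻ ω, N t ω B₁ ∂P ≠ ∞ ∧ ∫⁻ ω, N (t + h) ω B₂ ∂P ≠ ∞ ∧
    ∫⁻ ω, N t ω B₁ * N (t + h) ω B₂ ∂P ≠ ∞ ∧
    cov[fun ω => (N t ω B₁).toReal, fun ω => (N (t + h) ω B₂).toReal; P] =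
      κ t * κ (t + h) * rhoLag β c (t + h) t *
        (cLag β c t 1 ^ 2 * (∫⁻ θ, kernelMass ℓ K B₁ θ * kernelMass ℓ K B₂ θ ∂H).toReal
          + 2 * rhoLag β c t 1 * cLag β c t 1 *
            (∫⁻ θ, kernelMass ℓ K B₁ θ * kernelMass ℓ K B₂ θ ∂(meanMeasure P (W 1))).toReal)
      + κ t * κ (t + h) * rhoLag β c (t + h) t * rhoLag β c t 1 ^ 2 *
          cov[fun ω => ∫ θ, (kernelMass ℓ K B₁ θ).toReal ∂(W 1 ω),
            fun ω => ∫ θ, (kernelMass ℓ K B₂ θ).toReal ∂(W 1 ω); P]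
      + κ t * (if h = 0 then
          cLag β c t 1 * (∫⁻ θ, kernelMass ℓ K (B₁ ∩ B₂) θ ∂H).toReal
            + rhoLag β c t 1 * (∫⁻ θ, kernelMass ℓ K (B₁ ∩ B₂) θ ∂(meanMeasure P (W 1))).toReal
        else 0) := by
  have hW := hN.isMARG
  have hth : 1 ≤ t + h := by omega
  have mg₁ := measurable_kernelMass (ℓ := ℓ) hK B₁
  have mg₂ := measurable_kernelMass (ℓ := ℓ) hK B₂
  have mg := measurable_kernelMass (ℓ := ℓ) hK (B₁ ∩ B₂)
  have mg₁₂ : Measurable fun θ => kernelMass ℓ K B₁ θ * kernelMass ℓ K B₂ θ := mg₁.mul mg₂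
  have hle : ∀ θ, kernelMass ℓ K (B₁ ∩ B₂) θ ≤ kernelMass ℓ K B₁ θ := fun θ =>
    lintegral_mono_set Set.inter_subset_left
  have hW1 := hW.measurable 1 le_rfl
  obtain ⟨hM₁, hM₂, hM₁₂, hQ⟩ := hM
  rw [lintegral_add_measure, ENNReal.add_lt_top, lintegral_meanMeasure hW1 ‹_›] at hM₁ hM₂ hM₁₂
  have fH : ∫⁻ θ, kernelMass ℓ K (B₁ ∩ B₂) θ ∂H ≠ ∞ :=
    ((lintegral_mono hle).trans_lt hM₁.1).ne
  have fW : ∫⁻ ω, ∫⁻ θ, kernelMass ℓ K (B₁ ∩ B₂) θ ∂W 1 ω ∂P ≠ ∞ :=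
    ((lintegral_mono fun ω => lintegral_mono hle).trans_lt hM₁.2).ne
  have f₁ := hW.lintegral_lintegral_ne_top ht mg₁ hM₁.1.ne hM₁.2.ne
  have f₂ := hW.lintegral_lintegral_ne_top hth mg₂ hM₂.1.ne hM₂.2.ne
  have f := hW.lintegral_lintegral_ne_top ht mg fH fW
  have e := hW.toReal_lintegral_lintegral_eq ht mg fH fW
  obtain ⟨fQt, eQt⟩ := hW.toReal_lintegral_mul_eq ht mg₁ mg₂ hM₁.1.ne hM₂.1.ne hM₁₂.1.ne
    hM₁.2.ne hM₂.2.ne hM₁₂.2.ne hQ.ne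
  obtain ⟨fQ, eQ⟩ := hW.toReal_lintegral_mul_lag_eq ht mg₁ mg₂ hM₁.1.ne hM₂.1.ne
    hM₁.2.ne hM₂.2.ne fQt h
  have n₁ := hN.lintegral_apply hK ht hB₁
  have n₂ := hN.lintegral_apply hK hth hB₂
  have nn : ∫⁻ ω, N t ω B₁ * N (t + h) ω B₂ ∂P = κ t * κ (t + h) *
      ∫⁻ ω, (∫⁻ θ, kernelMass ℓ K B₁ θ ∂W t ω) * ∫⁻ θ, kernelMass ℓ K B₂ θ ∂W (t + h) ω ∂P +
      if h = 0 then κ t * ∫⁻ ω, ∫⁻ θ, kernelMass ℓ K (B₁ ∩ B₂) θ ∂W t ω ∂P else 0 := by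
    split_ifs with h0
    · subst h0
      exact hN.lintegral_apply_mul_apply_self hK ht hB₁ hB₂ f₁
    · rw [add_zero]
      exact hN.lintegral_apply_mul_apply_of_ne hK ht hth (by omega) hB₁ hB₂
  have fN₁ : ∫⁻ ω, N t ω B₁ ∂P ≠ ∞ := by
    rw [n₁]
    finiteness
  have fN₂ : ∫⁻ ω, N (t + h) ω B₂ ∂P ≠ ∞ := by
    rw [n₂]
    finiteness
  have fif : (if h = 0 then κ t * ∫⁻ ω, ∫⁻ θ, kernelMass ℓ K (B₁ ∩ B₂) θ ∂W t ω ∂P else 0) ≠ ∞ := by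
    split_ifs <;> finiteness
  have fNN : ∫⁻ ω, N t ω B₁ * N (t + h) ω B₂ ∂P ≠ ∞ := by
    rw [nn]
    finiteness
  -- For unbounded `B` the mass `K(B, θ)` may be infinite, where `toReal` returns `0`; a finite mean
  -- confines this to `W 1 ω`-null sets for almost every `ω`.
  have initial : ∀ {B : Set Y}, ∫⁻ ω, ∫⁻ θ, kernelMass ℓ K B θ ∂W 1 ω ∂P ≠ ∞ →
      (fun ω => ∫ θ, (kernelMass ℓ K B θ).toReal ∂(W 1 ω)) =ᵐ[P]
        fun ω => (∫⁻ θ, kernelMass ℓ K B θ ∂W 1 ω).toReal := fun {B} hB => by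
    have mB := measurable_kernelMass (ℓ := ℓ) hK B
    filter_upwards [ae_lt_top (hW.measurable_lintegral le_rfl mB) hB] with ω hω
    exact integral_toReal mB.aemeasurable (ae_lt_top mB hω.ne)
  refine ⟨fN₁, fN₂, fNN, ?_⟩
  rw [covariance_eq_toReal_sub (hN.measurable_apply ht hB₁) (hN.measurable_apply hth hB₂) fN₁ fN₂
      fNN (ae_eq_refl _) (ae_eq_refl _),
    covariance_eq_toReal_sub (hW.measurable_lintegral le_rfl mg₁)
      (hW.measurable_lintegral le_rfl mg₂) hM₁.2.ne hM₂.2.ne hQ.ne (initial hM₁.2.ne)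
      (initial hM₂.2.ne),
    nn, n₁, n₂, ENNReal.toReal_add (by finiteness) fif, lintegral_meanMeasure hW1 mg₁₂,
    lintegral_meanMeasure hW1 mg]
  simp only [ENNReal.toReal_mul, ENNReal.coe_toReal, apply_ite ENNReal.toReal,
    ENNReal.toReal_zero]
  rw [eQ, eQt, e]
  split_ifs <;> ring

end IsSNMARG

theorem corollary2 {Ω Θ Y : Type*} [MeasurableSpace Ω]
    [MetricSpace Θ] [PolishSpace Θ] [MeasurableSpace Θ] [BorelSpace Θ]
    [MetricSpace Y] [PolishSpace Y] [MeasurableSpace Y] [BorelSpace Y]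
    (P : Measure Ω) [IsProbabilityMeasure P]
    (H : Measure Θ) (β c : ℕ → ℝ) (W : ℕ → Ω → Measure Θ)
    (ℓ : Measure Y) [SigmaFinite ℓ]
    (K : Y → Θ → ℝ≥0) (hK : Measurable (Function.uncurry K))
    (κ : ℕ → ℝ≥0) (N : ℕ → Ω → Measure Y)
    (hN : IsSNMARG P H β c W ℓ K κ N)
    (hW₁ : IsBoundedlyFinite (meanMeasure P (W 1)))
    (hInt : IntegrabilityConditions P H (W 1) ℓ K)
    (B₁ B₂ : Set Y) (hB₁ : MeasurableSet B₁) (hB₂ : MeasurableSet B₂) :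
    -- for bounded sets, all the quantities are well defined
    (Bornology.IsBounded B₁ → Bornology.IsBounded B₂ →
      MomentsWellDefined P H (W 1) ℓ K B₁ B₂) ∧
    (MomentsWellDefined P H (W 1) ℓ K B₁ B₂ → ∀ t h : ℕ, 1 ≤ t →
      -- the covariance is a genuine one
      (∀ᵐ ω ∂P, N t ω B₁ < ∞) ∧ (∀ᵐ ω ∂P, N (t + h) ω B₂ < ∞) ∧
      Integrable (fun ω => (N t ω B₁).toReal) P ∧
      Integrable (fun ω => (N (t + h) ω B₂).toReal) P ∧
      Integrable (fun ω => (N t ω B₁).toReal * (N (t + h) ω B₂).toReal) P ∧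
      -- the formula, with `c_{t|1} β_{t|1}` written as `ρ_{t|1}`, for all `t ≥ 1`
      cov[fun ω => (N t ω B₁).toReal, fun ω => (N (t + h) ω B₂).toReal; P] =
        κ t * κ (t + h) * rhoLag β c (t + h) t *
          (cLag β c t 1 ^ 2 *
              ∫ θ, (kernelMass ℓ K B₁ θ).toReal * (kernelMass ℓ K B₂ θ).toReal ∂H
            + 2 * rhoLag β c t 1 * cLag β c t 1 *
              ∫ θ, (kernelMass ℓ K B₁ θ).toReal * (kernelMass ℓ K B₂ θ).toReal
                ∂(meanMeasure P (W 1)))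
        + κ t * κ (t + h) * rhoLag β c (t + h) t * rhoLag β c t 1 ^ 2 *
            cov[fun ω => ∫ θ, (kernelMass ℓ K B₁ θ).toReal ∂(W 1 ω),
              fun ω => ∫ θ, (kernelMass ℓ K B₂ θ).toReal ∂(W 1 ω); P]
        + κ t * (if h = 0 then
            cLag β c t 1 * ∫ θ, (kernelMass ℓ K (B₁ ∩ B₂) θ).toReal ∂H
              + rhoLag β c t 1 *
                ∫ θ, (kernelMass ℓ K (B₁ ∩ B₂) θ).toReal ∂(meanMeasure P (W 1))
          else 0) ∧
      -- the formula in terms of `β_{t|1}`, which is defined for `t ≥ 2`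
      (2 ≤ t →
        cov[fun ω => (N t ω B₁).toReal, fun ω => (N (t + h) ω B₂).toReal; P] =
          κ t * κ (t + h) * rhoLag β c (t + h) t * cLag β c t 1 ^ 2 *
            ∫ θ, (kernelMass ℓ K B₁ θ).toReal * (kernelMass ℓ K B₂ θ).toReal
              ∂(H + ENNReal.ofReal (2 * betaLag β c t 1) • meanMeasure P (W 1))
          + κ t * κ (t + h) * rhoLag β c (t + h) t * rhoLag β c t 1 ^ 2 *
              cov[fun ω => ∫ θ, (kernelMass ℓ K B₁ θ).toReal ∂(W 1 ω),
                fun ω => ∫ θ, (kernelMass ℓ K B₂ θ).toReal ∂(W 1 ω); P]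
          + κ t * (if h = 0 then
              ∫ θ, cLag β c t 1 * (kernelMass ℓ K (B₁ ∩ B₂) θ).toReal
                ∂(H + ENNReal.ofReal (betaLag β c t 1) • meanMeasure P (W 1))
            else 0))) := by
  have hW := hN.isMARG
  have hW1 := hW.measurable 1 le_rfl
  refine ⟨fun b₁ b₂ => hInt.momentsWellDefined hK hW.base_boundedlyFinite hW₁
    (hW.boundedlyFinite 1 le_rfl) hB₁ hB₂ b₁ b₂, fun hM t h ht => ?_⟩
  have hth : 1 ≤ t + h := by omega
  obtain ⟨fN₁, fN₂, fNN, hcov⟩ :=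
    hN.lintegral_counts_ne_top_and_covariance_eq hK hB₁ hB₂ hM ht h
  have mN₁ := hN.measurable_apply ht hB₁
  have mN₂ := hN.measurable_apply hth hB₂
  have mg := measurable_kernelMass (ℓ := ℓ) hK (B₁ ∩ B₂)
  have mg₁₂ : Measurable fun θ => kernelMass ℓ K B₁ θ * kernelMass ℓ K B₂ θ :=
    (measurable_kernelMass hK B₁).mul (measurable_kernelMass hK B₂)
  have toReal_eq : ∀ {g : Θ → ℝ≥0∞} {m : Measure Θ}, Measurable g → ∫⁻ θ, g θ ∂m ≠ ∞ →
      ∫ θ, (g θ).toReal ∂m = (∫⁻ θ, g θ ∂m).toReal := fun hg hf =>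
    integral_toReal hg.aemeasurable (ae_lt_top hg hf)
  have toReal_add_eq : ∀ {g : Θ → ℝ≥0∞} {m m' : Measure Θ} {b : ℝ}, 0 ≤ b → Measurable g →
      ∫⁻ θ, g θ ∂m ≠ ∞ → ∫⁻ θ, g θ ∂m' ≠ ∞ →
      ∫ θ, (g θ).toReal ∂(m + ENNReal.ofReal b • m') =
        (∫⁻ θ, g θ ∂m).toReal + b * (∫⁻ θ, g θ ∂m').toReal := fun {g m m' b} hb hg hf hf' => by
    have e : ∫⁻ θ, g θ ∂(m + ENNReal.ofReal b • m') =
        ∫⁻ θ, g θ ∂m + ENNReal.ofReal b * ∫⁻ θ, g θ ∂m' := by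
      rw [lintegral_add_measure, lintegral_smul_measure, smul_eq_mul]
    rw [toReal_eq hg (by rw [e]; finiteness), e, ENNReal.toReal_add hf (by finiteness),
      ENNReal.toReal_mul, ENNReal.toReal_ofReal hb]
  have f₁₂ := hM.mixed
  have f : ∫⁻ θ, kernelMass ℓ K (B₁ ∩ B₂) θ ∂(H + meanMeasure P (W 1)) < ∞ :=
    (lintegral_mono fun θ => lintegral_mono_set Set.inter_subset_left).trans_lt hM.mean₁
  rw [lintegral_add_measure, ENNReal.add_lt_top] at f₁₂ f
  refine ⟨ae_lt_top mN₁ fN₁, ae_lt_top mN₂ fN₂,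
    integrable_toReal_of_lintegral_ne_top mN₁.aemeasurable fN₁,
    integrable_toReal_of_lintegral_ne_top mN₂.aemeasurable fN₂,
    integrable_toReal_mul_toReal mN₁ mN₂ fNN, ?_, fun ht2 => ?_⟩
  · simp only [← ENNReal.toReal_mul]
    rw [hcov, toReal_eq mg₁₂ f₁₂.1.ne, toReal_eq mg₁₂ f₁₂.2.ne, toReal_eq mg f.1.ne,
      toReal_eq mg f.2.ne]
  · have hcl := cLag_pos hW.beta_pos hW.c_pos le_rfl (show 1 < t by omega)
    -- This needs `c_{t|1} ≠ 0`, hence `t ≥ 2`: at `t = 1` the left side is `1` and the right side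
    -- `0`.
    have hρ : rhoLag β c t 1 = cLag β c t 1 * betaLag β c t 1 := by
      rw [betaLag]
      field_simp
    have hb : 0 ≤ betaLag β c t 1 :=
      div_nonneg (rhoLag_pos hW.beta_pos hW.c_pos le_rfl).le hcl.le
    simp only [← ENNReal.toReal_mul, integral_const_mul]
    rw [hcov, toReal_add_eq (by positivity) mg₁₂ f₁₂.1.ne f₁₂.2.ne,
      toReal_add_eq hb mg f.1.ne f.2.ne, hρ]
    split_ifs <;> ring
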